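/- **Setting.** Let $\mathcal G$ be a directed acyclic graph on $\{1,\dots,p\}$, let $P_i$ be the set of parents of $i$, and fix $m\ge 0$, hyperparameters $\delta,\tau>0$ and a positive definite $m\times m$ matrix $V$. For an $n\times p$ data matrix $\boldsymbol X=(\boldsymbol x_1,\dots,\boldsymbol x_p)$, let $\boldsymbol x_{P_i}$ be the matrix of the columns $\boldsymbol x_j$, $j\in P_i$, and let $Q$ be an $n\times m$ matrix of exogenous variables of full column rank. Let $P$ be an $n\times(n-m)$ matrix with $P^TQ=0$, $P^TP=I$, $PP^T=I-Q(Q^TQ)^{-1}Q^T$. Independently over $i$, the parameters $(\boldsymbol\gamma_i,\psi_i)\in\mathbb R^{P_i}\times(0,\infty)$ have the prior $$\boldsymbol\gamma_i\mid\psi_i\sim N(0,\tau^{-1}\psi_i I),\qquad \psi_i\sim \text{Inverse Gamma}\Big(\frac{\delta+|P_i|}2,\frac\tau2\Big).$$ They determine the covariance matrix $\Sigma=(I-\Gamma)^{-1}\operatorname{diag}(\psi_1,\dots,\psi_p)(I-\Gamma)^{-T}$, where $\Gamma_{ij}=\gamma_{ij}$ for $j\in P_i$ and $\Gamma_{ij}=0$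 otherwise. * *Bayesian approach.* In addition $\boldsymbol b_i\mid\psi_i\sim N_m(0,\psi_iV)$, conditionally independent of $\boldsymbol\gamma_i$ given $\psi_i$, and the likelihood is $\prod_i f(\boldsymbol x_i\mid \boldsymbol x_{P_i})$ with $\boldsymbol x_i\mid\boldsymbol x_{P_i},\boldsymbol\gamma_i,\psi_i,\boldsymbol b_i\sim N(\boldsymbol x_{P_i}\boldsymbol\gamma_i+Q\boldsymbol b_i,\psi_iI)$. Let $f_B(\Sigma\mid\boldsymbol X)$ be the resulting posterior distribution of $\Sigma$. * *Residual approach.* The likelihood is that of $P^T\boldsymbol X$, with $P^T\boldsymbol x_i\sim N_{n-m}(P^T\boldsymbol x_{P_i}\boldsymbol\gamma_i,\psi_iI)$. Let $f_R(\Sigma\mid\boldsymbol X)$ be the resulting posterior distribution of $\Sigma$. Let $D_\Sigma\{f_B(\Sigma\mid\boldsymbol X),f_R(\Sigma\mid\boldsymbol X)\}$ be the Kullback–Leibler divergence of these two distributions. **Theorem.** As $n\to\infty$, $D_\Sigma\{f_B(\Sigma\mid\boldsymbol X),f_R(\Sigma\mid\boldsymbol X)\}\to0$, in each of the following two situations.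 1. *(Data from the model.)* The data are the first $n$ samples from the Gaussian linear model over $\mathcal G$: there are fixed $\boldsymbol\gamma_i\in\mathbb R^{P_i}$, $\psi_i>0$, $\boldsymbol b_i\in\mathbb R^m$ and rows $\boldsymbol q_t\in\mathbb R^m$, $t\ge1$, with $$x_{ti}=\sum_{j\in P_i}\gamma_{ij}x_{tj}+\boldsymbol q_t^T\boldsymbol b_i+\varepsilon_{ti},\qquad \varepsilon_{ti}\sim N(0,\psi_i)\text{ independent},$$ and $Q=Q_n$, with rows $\boldsymbol q_1,\dots,\boldsymbol q_n$, has rank $m$ for some $n$ (hence for all larger $n$). Then the convergence holds almost surely. 2. *(Given data.)* $\boldsymbol X=\boldsymbol X_n$ and $Q=Q_n$ are arbitrary sequences of matrices such that, for some constants $c>0$ and $C$ and all large $n$, $\boldsymbol x_i^T\boldsymbol x_i\le Cn$ for every $i$ (for instance, data centred and scaled so that $\boldsymbol x_i^T\boldsymbol x_i=n-1$) and $$\|\boldsymbol X_nu+Q_nv\|^2\ge c\,n\,(\|u\|^2+\|v\|^2)\qquad\text{for all }u\in\mathbb R^p,\ v\in\mathbb R^m .$$ -/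

import Mathlib

open MeasureTheory ProbabilityTheory Filter Topology
open scoped Matrix ENNReal NNReal

noncomputable section

namespace ExoNetwork

/-- The density of the inverse gamma distribution with shape `a` and scale `β`. -/
def invGammaDensity (a β x : ℝ) : ℝ :=
  if 0 < x then β ^ a / Real.Gamma a * x ^ (-a - 1) * Real.exp (-β / x) else 0

/-- The density of the multivariate normal distribution `N(μ, S)`, for positive definite `S`. -/
def normalDensity {ι : Type*} [Fintype ι] [DecidableEq ι]
    (μ : ι → ℝ) (S : Matrix ι ι ℝ) (x : ι → ℝ) : ℝ :=
  (√((2 * Real.pi) ^ Fintype.card ι * S.det))⁻¹ *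
    Real.exp (-(1 / 2) * ((x - μ) ⬝ᵥ (S⁻¹ *ᵥ (x - μ))))

/-- Bayes' theorem: the posterior distribution on `Θ` for a prior density and a likelihood,
that is, the probability measure with Lebesgue density proportional to their product. -/
def posterior {Θ : Type*} [MeasureSpace Θ] (prior likelihood : Θ → ℝ) : Measure Θ :=
  (∫⁻ θ, ENNReal.ofReal (prior θ * likelihood θ))⁻¹ •
    (volume : Measure Θ).withDensity (fun θ => ENNReal.ofReal (prior θ * likelihood θ))

/-- The entrywise (Borel) sigma-algebra on real square matrices. -/
instance matrixMeasurableSpace {p : ℕ} : MeasurableSpace (Matrix (Fin p) (Fin p) ℝ) :=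
  inferInstanceAs (MeasurableSpace (Fin p → Fin p → ℝ))

/-- A directed graph is acyclic if no vertex lies on a directed cycle (or loop). -/
def IsAcyclic {W : Type*} (G : Digraph W) : Prop :=
  ∀ v, ¬ Relation.TransGen G.Adj v v

/-- The index set of the parents of the vertex `i`. -/
abbrev Parents {p : ℕ} (G : Digraph (Fin p)) (i : Fin p) : Type :=
  {j : Fin p // G.Adj j i}

/-- The network parameters `(γ_i, ψ_i)`, `i = 1, …, p`. -/
abbrev Params {p : ℕ} (G : Digraph (Fin p)) : Type :=
  (i : Fin p) → (Parents G i → ℝ) × ℝ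

/-- The network parameters with the effects of `m` exogenous variables:
`((γ_i, ψ_i), b_i)`, `i = 1, …, p`. -/
abbrev FullParams {p : ℕ} (G : Digraph (Fin p)) (m : ℕ) : Type :=
  (i : Fin p) → ((Parents G i → ℝ) × ℝ) × (Fin m → ℝ)

section

variable {p m n k : ℕ} (G : Digraph (Fin p)) [DecidableRel G.Adj]

/-- The prior density of `(γ_i, ψ_i)`:
`γ_i | ψ_i ~ N(0, τ⁻¹ ψ_i I)` and `ψ_i ~ InverseGamma((δ + |P_i|) / 2, τ / 2)`. -/
def nodePrior (δ τ : ℝ) (i : Fin p) (θ : (Parents G i → ℝ) × ℝ) : ℝ :=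
  normalDensity 0 ((τ⁻¹ * θ.2) • (1 : Matrix (Parents G i) (Parents G i) ℝ)) θ.1 *
    invGammaDensity ((δ + Fintype.card (Parents G i)) / 2) (τ / 2) θ.2

/-- The columns of the data matrix that belong to the parents of `i`. -/
def parentData (X : Matrix (Fin n) (Fin p) ℝ) (i : Fin p) : Matrix (Fin n) (Parents G i) ℝ :=
  X.submatrix id Subtype.val

/-- The prior density of the Bayesian approach:
independently over `i`, the density `nodePrior` for `(γ_i, ψ_i)` times that of
`b_i | ψ_i ~ N(0, ψ_i V)`. -/
def bayesPrior (δ τ : ℝ) (V : Matrix (Fin m) (Fin m) ℝ) (θ : FullParams G m) : ℝ :=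
  ∏ i, nodePrior G δ τ i (θ i).1 * normalDensity 0 ((θ i).1.2 • V) (θ i).2

/-- The likelihood of the data `X` in the Gaussian linear model with exogenous variables:
`x_i | x_{P_i} ~ N(x_{P_i} γ_i + Q b_i, ψ_i I)`. -/
def bayesLikelihood (Q : Matrix (Fin n) (Fin m) ℝ) (X : Matrix (Fin n) (Fin p) ℝ)
    (θ : FullParams G m) : ℝ :=
  ∏ i, normalDensity (parentData G X i *ᵥ (θ i).1.1 + Q *ᵥ (θ i).2)
    ((θ i).1.2 • (1 : Matrix (Fin n) (Fin n) ℝ)) (X.col i)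

/-- The prior density of the residual approach. -/
def residualPrior (δ τ : ℝ) (θ : Params G) : ℝ :=
  ∏ i, nodePrior G δ τ i (θ i)

/-- The likelihood of the transformed data `Pᵀ X`:
`Pᵀ x_i | Pᵀ x_{P_i} ~ N(Pᵀ x_{P_i} γ_i, ψ_i I)`. -/
def residualLikelihood (P : Matrix (Fin n) (Fin k) ℝ) (X : Matrix (Fin n) (Fin p) ℝ)
    (θ : Params G) : ℝ :=
  ∏ i, normalDensity ((Pᵀ * parentData G X i) *ᵥ (θ i).1)
    ((θ i).2 • (1 : Matrix (Fin k) (Fin k) ℝ)) (Pᵀ *ᵥ X.col i)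

/-- The `p × p` matrix of regression coefficients: its entry at `(i, j)` is the coefficient of
`X_j` in the regression of `X_i` on its parents. -/
def coefMatrix (θ : Params G) : Matrix (Fin p) (Fin p) ℝ :=
  Matrix.of fun i j => if h : G.Adj j i then (θ i).1 ⟨j, h⟩ else 0

/-- The covariance matrix `Σ = (I - Γ)⁻¹ diag(ψ) (I - Γ)⁻ᵀ` of the network with
parameters `θ`, where `Γ` is the matrix of regression coefficients. -/
def covMatrix (θ : Params G) : Matrix (Fin p) (Fin p) ℝ :=
  (1 - coefMatrix G θ)⁻¹ * Matrix.diagonal (fun i => (θ i).2) * ((1 - coefMatrix G θ)⁻¹)ᵀ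

/-- The posterior distribution of `Σ` under the Bayesian approach. -/
def bayesPosteriorCov (δ τ : ℝ) (V : Matrix (Fin m) (Fin m) ℝ)
    (Q : Matrix (Fin n) (Fin m) ℝ) (X : Matrix (Fin n) (Fin p) ℝ) :
    Measure (Matrix (Fin p) (Fin p) ℝ) :=
  (posterior (bayesPrior G δ τ V) (bayesLikelihood G Q X)).map
    (fun θ => covMatrix G (fun i => (θ i).1))

/-- The posterior distribution of `Σ` under the residual approach. -/
def residualPosteriorCov (δ τ : ℝ) (P : Matrix (Fin n) (Fin k) ℝ)
    (X : Matrix (Fin n) (Fin p) ℝ) : Measure (Matrix (Fin p) (Fin p) ℝ) :=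
  (posterior (residualPrior G δ τ) (residualLikelihood G P X)).map (covMatrix G)

/-- The Kullback–Leibler divergence between the posterior distributions of `Σ` under the
Bayesian approach and under the residual approach. -/
def covDivergence (δ τ : ℝ) (V : Matrix (Fin m) (Fin m) ℝ) (Q : Matrix (Fin n) (Fin m) ℝ)
    (P : Matrix (Fin n) (Fin k) ℝ) (X : Matrix (Fin n) (Fin p) ℝ) : ℝ≥0∞ :=
  InformationTheory.klDiv (bayesPosteriorCov G δ τ V Q X) (residualPosteriorCov G δ τ P X)

end

/-- `P` is a matrix of residual contrasts for `Q`: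
`Pᵀ Q = 0`, `Pᵀ P = I` and `P Pᵀ = I - Q (Qᵀ Q)⁻¹ Qᵀ`. -/
def IsResidualContrast {n m k : ℕ} (Q : Matrix (Fin n) (Fin m) ℝ)
    (P : Matrix (Fin n) (Fin k) ℝ) : Prop :=
  Pᵀ * Q = 0 ∧ Pᵀ * P = 1 ∧ P * Pᵀ = 1 - Q * (Qᵀ * Q)⁻¹ * Qᵀ

/-- The `n × m` matrix of the first `n` rows of an infinite array. -/
def firstRows {m : ℕ} (A : ℕ → Fin m → ℝ) (n : ℕ) : Matrix (Fin n) (Fin m) ℝ :=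
  Matrix.of fun t j => A t j

/-- The samples `x t = (x t 1, …, x t p)`, `t = 0, 1, 2, …`, follow the Gaussian linear model
over `G` with parameters `γ_i, ψ_i`, exogenous variables `q` and effects `b_i`:
given its parents, `x t i ~ N(∑_{j ∈ P_i} γ_{ij} x_{t j} + (q b_i)_t, ψ_i)`, all errors being
independent. -/
def FollowsModel {p m : ℕ} (G : Digraph (Fin p)) [DecidableRel G.Adj]
    {Ω : Type*} [MeasurableSpace Ω] (μ : Measure Ω)
    (γ : (i : Fin p) → Parents G i → ℝ) (ψ : Fin p → ℝ≥0) (b : Fin p → Fin m → ℝ)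
    (q : ℕ → Fin m → ℝ) (x : ℕ → Fin p → Ω → ℝ) : Prop :=
  ∃ ε : ℕ × Fin p → Ω → ℝ,
    iIndepFun ε μ ∧
    (∀ t i, HasLaw (ε (t, i)) (gaussianReal 0 (ψ i)) μ) ∧
    ∀ t i ω, x t i ω = ∑ j : Parents G i, γ i j * x t j ω + q t ⬝ᵥ b i + ε (t, i) ω

end ExoNetwork

end

/-! By conjugacy, the Bayesian and the residual posterior of `Σ` are images of products, over the
nodes, of normal inverse gamma distributions of `(γ_i, ψ_i)` which have the same shape and differ
only in the Gram matrix of the data: `S = Xᵀ P Pᵀ X` for the residual approach and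
`B = Xᵀ (I + Q V Qᵀ)⁻¹ X` for the Bayesian one. Here `0 ≤ B - S`, and `B - S ≤ ρ S` as soon as the
least squares coefficients of the columns of `X` on `Q` are small compared with the residuals.
The Kullback-Leibler divergence is at most the `χ²` divergence, which is explicit for normal
inverse gamma densities and multiplicative over the nodes, and its factors tend to `1` when
`√n ρ → 0`. For given data `ρ` is of order `1 / n`. For data from the model the law of large
numbers bounds the residuals from below, while the projections of the errors on the columns of `Q`
are sub-Gaussian contrasts, so that by Borel-Cantelli `ρ` is at most of order `log n / n`. -/

namespace ExoNetwork

/-! ### Products of densities and their Kullback–Leibler divergence -/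

section Density

lemma lintegral_pi_prod {ι : Type*} [Fintype ι] {E : ι → Type*} [∀ i, MeasurableSpace (E i)]
    (μ : (i : ι) → Measure (E i)) [∀ i, SigmaFinite (μ i)] {f : (i : ι) → E i → ℝ≥0∞}
    (hf : ∀ i, Measurable (f i)) :
    ∫⁻ x, ∏ i, f i (x i) ∂(Measure.pi μ) = ∏ i, ∫⁻ x, f i x ∂(μ i) := by
  classical
  rcases isEmpty_or_nonempty ((i : ι) → E i) with hE | ⟨⟨x⟩⟩
  · obtain ⟨i, hi⟩ := isEmpty_pi.1 hE
    rw [Finset.prod_eq_zero (Finset.mem_univ i) (by simp), lintegral_of_isEmpty]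
  have key : ∀ (s : Finset ι) (c : ℝ≥0∞) (x : (i : ι) → E i),
      (∫⋯∫⁻_s, (fun x => c * ∏ i ∈ s, f i (x i)) ∂μ) x = c * ∏ i ∈ s, ∫⁻ x, f i x ∂(μ i) := by
    intro s
    induction s using Finset.induction_on with
    | empty => simp
    | insert i s hi ih =>
      intro c x
      have hprod : ∀ (x : (i : ι) → E i) y,
          ∏ j ∈ s, f j (Function.update x i y j) = ∏ j ∈ s, f j (x j) := fun x y =>
        Finset.prod_congr rfl fun j hj => by
          rw [Function.update_of_ne (ne_of_mem_of_not_mem hj hi)]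
      rw [lmarginal_insert' _ (by fun_prop) hi]
      simp only [Finset.prod_insert hi, Function.update_self, hprod, ← mul_assoc,
        lintegral_mul_const _ ((hf i).const_mul _), lintegral_const_mul _ (hf i), ih]
  simpa [lmarginal_univ] using key Finset.univ 1 x

lemma pi_withDensity {ι : Type*} [Fintype ι] {E : ι → Type*} [∀ i, MeasurableSpace (E i)]
    (μ : (i : ι) → Measure (E i)) [∀ i, SigmaFinite (μ i)] {f : (i : ι) → E i → ℝ≥0∞}
    (hf : ∀ i, Measurable (f i)) [∀ i, SigmaFinite ((μ i).withDensity (f i))] :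
    Measure.pi (fun i => (μ i).withDensity (f i)) =
      (Measure.pi μ).withDensity fun x => ∏ i, f i (x i) := by
  refine Measure.pi_eq fun s hs => ?_
  have hprod : (Set.univ.pi s).indicator (fun x => ∏ i, f i (x i)) =
      fun x => ∏ i, (s i).indicator (f i) (x i) := by
    funext x
    by_cases hx : x ∈ Set.univ.pi s
    · rw [Set.indicator_of_mem hx]
      exact Finset.prod_congr rfl fun i _ => (Set.indicator_of_mem (hx i trivial) _).symm
    · rw [Set.indicator_of_notMem hx]
      obtain ⟨i, hi⟩ : ∃ i, x i ∉ s i := by simpa [Set.mem_pi] using hx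
      exact (Finset.prod_eq_zero (Finset.mem_univ i) (Set.indicator_of_notMem hi _)).symm
  rw [withDensity_apply _ (.univ_pi hs), ← lintegral_indicator (.univ_pi hs), hprod,
    lintegral_pi_prod μ fun i => (hf i).indicator (hs i)]
  exact Finset.prod_congr rfl fun i _ => by
    rw [lintegral_indicator (hs i), withDensity_apply _ (hs i)]

lemma klFun_add_two_mul_le {x : ℝ} (hx : 0 ≤ x) :
    InformationTheory.klFun x + 2 * x ≤ x ^ 2 + 1 := by
  rw [InformationTheory.klFun_apply]
  rcases hx.eq_or_lt with rfl | hx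
  · simp
  · nlinarith [mul_le_mul_of_nonneg_left (Real.log_le_sub_one_of_pos hx) hx.le]

lemma ofReal_klFun_toReal_add_two_mul_le {y : ℝ≥0∞} (hy : y ≠ ∞) :
    ENNReal.ofReal (InformationTheory.klFun y.toReal) + 2 * y ≤ y ^ 2 + 1 := by
  lift y to ℝ≥0 using hy
  have h := ENNReal.ofReal_le_ofReal (klFun_add_two_mul_le y.coe_nonneg)
  rw [ENNReal.ofReal_add (InformationTheory.klFun_nonneg y.coe_nonneg) (by positivity),
    ENNReal.ofReal_add (by positivity) zero_le_one, ENNReal.ofReal_mul zero_le_two,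
    ENNReal.ofReal_pow y.coe_nonneg] at h
  simpa using h

lemma klDiv_withDensity_add_one_le {α : Type*} [MeasurableSpace α] (ν : Measure α)
    [IsProbabilityMeasure ν] {r : α → ℝ≥0∞} (hr : Measurable r)
    [IsProbabilityMeasure (ν.withDensity r)] :
    InformationTheory.klDiv (ν.withDensity r) ν + 1 ≤ ∫⁻ x, r x ^ 2 ∂ν := by
  have hr1 : ∫⁻ x, r x ∂ν = 1 := by
    rw [← setLIntegral_univ, ← withDensity_apply _ .univ, measure_univ]
  have hfin : ∀ᵐ x ∂ν, r x < ∞ := ae_lt_top hr (by simp [hr1])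
  rw [InformationTheory.klDiv_eq_lintegral_klFun_of_ac (withDensity_absolutelyContinuous ν r)]
  have hint : ∫⁻ x, ENNReal.ofReal (InformationTheory.klFun
        (((ν.withDensity r).rnDeriv ν x).toReal)) + 2 * r x ∂ν ≤ ∫⁻ x, r x ^ 2 + 1 ∂ν := by
    refine lintegral_mono_ae ?_
    filter_upwards [Measure.rnDeriv_withDensity ν hr, hfin] with x hx hfx
    rw [hx]
    exact ofReal_klFun_toReal_add_two_mul_le hfx.ne
  rw [lintegral_add_right _ (hr.const_mul 2), lintegral_const_mul _ hr, hr1,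
    lintegral_add_right _ measurable_const, lintegral_one, measure_univ, mul_one,
    ← one_add_one_eq_two, ← add_assoc] at hint
  exact (ENNReal.add_le_add_iff_right ENNReal.one_ne_top).1 hint

/-- The probability measure with Lebesgue density proportional to `h`; it is only meaningful when
the integral of `h` is neither `0` nor `∞`. -/
noncomputable def normalizedDensity {Θ : Type*} [MeasureSpace Θ] (h : Θ → ℝ≥0∞) : Measure Θ :=
  (∫⁻ θ, h θ)⁻¹ • (volume : Measure Θ).withDensity h

variable {Θ : Type*} [MeasureSpace Θ]

lemma isProbabilityMeasure_normalizedDensity {h : Θ → ℝ≥0∞} (h_zero : ∫⁻ θ, h θ ≠ 0)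
    (h_top : ∫⁻ θ, h θ ≠ ∞) : IsProbabilityMeasure (normalizedDensity h) :=
  ⟨by simp [normalizedDensity, ENNReal.inv_mul_cancel h_zero h_top]⟩

lemma normalizedDensity_const_mul {h : Θ → ℝ≥0∞} (hh : Measurable h) {c : ℝ≥0∞} (hc : c ≠ 0)
    (hc' : c ≠ ∞) : normalizedDensity (fun θ => c * h θ) = normalizedDensity h := by
  have hmul : (fun θ => c * h θ) = c • h := rfl
  rw [normalizedDensity, normalizedDensity, lintegral_const_mul _ hh, hmul,
    withDensity_smul _ hh, smul_smul, ENNReal.mul_inv (Or.inl hc) (Or.inl hc'), mul_right_comm,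
    ENNReal.inv_mul_cancel hc hc', one_mul]

lemma normalizedDensity_eq_withDensity {h : Θ → ℝ≥0∞} (hh : Measurable h) :
    normalizedDensity h = volume.withDensity fun θ => (∫⁻ θ, h θ)⁻¹ * h θ :=
  (withDensity_smul _ hh).symm

lemma map_fst_normalizedDensity {A B : Type*} [MeasureSpace A] [MeasureSpace B]
    [SFinite (volume : Measure A)] [SFinite (volume : Measure B)] {h : A × B → ℝ≥0∞}
    (hh : Measurable h) :
    (normalizedDensity h).map Prod.fst = normalizedDensity fun a => ∫⁻ b, h (a, b) := by
  rw [normalizedDensity, normalizedDensity, Measure.map_smul, Measure.volume_eq_prod,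
    lintegral_prod _ hh.aemeasurable]
  congr 1
  ext s hs
  rw [Measure.map_apply measurable_fst hs, withDensity_apply _ (measurable_fst hs),
    withDensity_apply _ hs, ← Set.prod_univ, setLIntegral_prod _ hh.aemeasurable.restrict]
  simp only [Measure.restrict_univ]

lemma pi_normalizedDensity {ι : Type*} [Fintype ι] {E : ι → Type*} [∀ i, MeasureSpace (E i)]
    [∀ i, SigmaFinite (volume : Measure (E i))] {h : (i : ι) → E i → ℝ≥0∞}
    (hh : ∀ i, Measurable (h i)) (h_zero : ∀ i, ∫⁻ θ, h i θ ≠ 0)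
    (h_top : ∀ i, ∫⁻ θ, h i θ ≠ ∞) :
    Measure.pi (fun i => normalizedDensity (h i)) = normalizedDensity fun θ => ∏ i, h i (θ i) := by
  have hprob : ∀ i, IsProbabilityMeasure
      (volume.withDensity fun θ => (∫⁻ θ, h i θ)⁻¹ * h i θ) := fun i => by
    rw [← normalizedDensity_eq_withDensity (hh i)]
    exact isProbabilityMeasure_normalizedDensity (h_zero i) (h_top i)
  simp only [fun i => normalizedDensity_eq_withDensity (hh i)]
  rw [pi_withDensity _ fun i => (hh i).const_mul _, normalizedDensity_eq_withDensity (by fun_prop),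
    volume_pi, lintegral_pi_prod _ hh,
    ENNReal.prod_inv_distrib fun i _ _ _ _ => Or.inl (h_zero i)]
  simp only [Finset.prod_mul_distrib]

/-- The density of `normalizedDensity f` with respect to `normalizedDensity g`. -/
noncomputable def densityRatio (f g : Θ → ℝ≥0∞) (θ : Θ) : ℝ≥0∞ :=
  (∫⁻ θ, f θ)⁻¹ * (∫⁻ θ, g θ) * (f θ * (g θ)⁻¹)

lemma measurable_densityRatio {f g : Θ → ℝ≥0∞} (hf : Measurable f) (hg : Measurable g) :
    Measurable (densityRatio f g) := by
  unfold densityRatio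
  fun_prop

lemma withDensity_densityRatio {f g : Θ → ℝ≥0∞} (hf : Measurable f) (hg : Measurable g)
    (hfg : ∀ θ, g θ = 0 → f θ = 0) (hg_top : ∀ θ, g θ ≠ ∞) (hg0 : ∫⁻ θ, g θ ≠ 0)
    (hg1 : ∫⁻ θ, g θ ≠ ∞) :
    (normalizedDensity g).withDensity (densityRatio f g) = normalizedDensity f := by
  rw [normalizedDensity_eq_withDensity hf, normalizedDensity_eq_withDensity hg,
    ← withDensity_mul _ (by fun_prop) (measurable_densityRatio hf hg)]
  congr 1
  funext θ
  simp only [Pi.mul_apply, densityRatio]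
  by_cases h : g θ = 0
  · simp [h, hfg θ h]
  · calc (∫⁻ θ, g θ)⁻¹ * g θ * ((∫⁻ θ, f θ)⁻¹ * (∫⁻ θ, g θ) * (f θ * (g θ)⁻¹))
        = ((∫⁻ θ, g θ)⁻¹ * ∫⁻ θ, g θ) * (g θ * (g θ)⁻¹) * ((∫⁻ θ, f θ)⁻¹ * f θ) := by ring
      _ = (∫⁻ θ, f θ)⁻¹ * f θ := by
          rw [ENNReal.inv_mul_cancel hg0 hg1, ENNReal.mul_inv_cancel h (hg_top θ), one_mul, one_mul]

lemma lintegral_densityRatio_sq_le {f g k : Θ → ℝ≥0∞} (hf : Measurable f) (hg : Measurable g)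
    (hk : Measurable k) (hkg : ∀ θ, k θ * g θ = f θ ^ 2) (hg_top : ∀ θ, g θ ≠ ∞)
    (hg0 : ∫⁻ θ, g θ ≠ 0) (hg1 : ∫⁻ θ, g θ ≠ ∞) :
    ∫⁻ θ, densityRatio f g θ ^ 2 ∂(normalizedDensity g) ≤
      (∫⁻ θ, k θ) * (∫⁻ θ, g θ) * ((∫⁻ θ, f θ) ^ 2)⁻¹ := by
  set F := ∫⁻ θ, f θ with hF
  set Z := ∫⁻ θ, g θ with hZ
  have hle : ∀ θ, g θ * densityRatio f g θ ^ 2 ≤ (F⁻¹ * Z) ^ 2 * k θ := by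
    intro θ
    rw [densityRatio, ← hF, ← hZ]
    by_cases h : g θ = 0
    · simp [h]
    · calc g θ * (F⁻¹ * Z * (f θ * (g θ)⁻¹)) ^ 2
          = (F⁻¹ * Z) ^ 2 * (f θ ^ 2 * (g θ)⁻¹) * (g θ * (g θ)⁻¹) := by ring
        _ = (F⁻¹ * Z) ^ 2 * k θ * (g θ * (g θ)⁻¹) ^ 2 := by rw [← hkg]; ring
        _ ≤ _ := by simp [ENNReal.mul_inv_cancel h (hg_top θ)]
  have hm := measurable_densityRatio hf hg
  rw [normalizedDensity, lintegral_smul_measure,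
    lintegral_withDensity_eq_lintegral_mul _ hg (by fun_prop)]
  calc Z⁻¹ * ∫⁻ θ, g θ * densityRatio f g θ ^ 2
      ≤ Z⁻¹ * ((F⁻¹ * Z) ^ 2 * ∫⁻ θ, k θ) := by
        rw [← lintegral_const_mul _ hk]
        exact mul_le_mul_right (lintegral_mono hle) _
    _ = (Z⁻¹ * Z) * ((∫⁻ θ, k θ) * Z * (F⁻¹) ^ 2) := by ring
    _ = _ := by rw [ENNReal.inv_mul_cancel hg0 hg1, one_mul, ENNReal.inv_pow]

-- The divergence is at most the chi-squared divergence, and one plus the latter is multiplicative.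
lemma klDiv_pi_normalizedDensity_add_one_le {ι : Type*} [Fintype ι] {E : ι → Type*}
    [∀ i, MeasureSpace (E i)] [∀ i, SigmaFinite (volume : Measure (E i))]
    {f g k : (i : ι) → E i → ℝ≥0∞} (hf : ∀ i, Measurable (f i)) (hg : ∀ i, Measurable (g i))
    (hk : ∀ i, Measurable (k i)) (hkg : ∀ i θ, k i θ * g i θ = f i θ ^ 2)
    (hg_top : ∀ i θ, g i θ ≠ ∞) (hf0 : ∀ i, ∫⁻ θ, f i θ ≠ 0) (hf1 : ∀ i, ∫⁻ θ, f i θ ≠ ∞)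
    (hg0 : ∀ i, ∫⁻ θ, g i θ ≠ 0) (hg1 : ∀ i, ∫⁻ θ, g i θ ≠ ∞) :
    InformationTheory.klDiv (Measure.pi fun i => normalizedDensity (f i))
        (Measure.pi fun i => normalizedDensity (g i)) + 1 ≤
      ∏ i, (∫⁻ θ, k i θ) * (∫⁻ θ, g i θ) * ((∫⁻ θ, f i θ) ^ 2)⁻¹ := by
  have hfg : ∀ i θ, g i θ = 0 → f i θ = 0 := fun i θ h => by simpa [h] using (hkg i θ).symm
  have hr := fun i => measurable_densityRatio (hf i) (hg i)
  have hprob_g := fun i => isProbabilityMeasure_normalizedDensity (hg0 i) (hg1 i)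
  have hprob_f := fun i => isProbabilityMeasure_normalizedDensity (hf0 i) (hf1 i)
  simp only [← fun i => withDensity_densityRatio (hf i) (hg i) (hfg i) (hg_top i) (hg0 i) (hg1 i)]
    at hprob_f ⊢
  have hprob_pi : IsProbabilityMeasure (Measure.pi fun i =>
      (normalizedDensity (g i)).withDensity (densityRatio (f i) (g i))) := inferInstance
  rw [pi_withDensity _ hr] at hprob_pi ⊢
  refine (klDiv_withDensity_add_one_le _ (by fun_prop)).trans ?_
  simp only [← Finset.prod_pow]
  rw [lintegral_pi_prod _ fun i => (hr i).pow_const 2]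
  exact Finset.prod_le_prod' fun i _ =>
    lintegral_densityRatio_sq_le (hf i) (hg i) (hk i) (hkg i) (hg_top i) (hg0 i) (hg1 i)

end Density

/-! ### Quadratic forms -/

section QuadraticForm

lemma posSemidef_conj {ι κ : Type*} [Finite ι] [Fintype κ] {A : Matrix κ κ ℝ} (hA : A.PosSemidef)
    (J : Matrix κ ι ℝ) : (Jᵀ * A * J).PosSemidef := by
  simpa only [Matrix.conjTranspose_eq_transpose_of_trivial] using hA.conjTranspose_mul_mul_same J

variable {ι κ : Type*} [Fintype ι] [Fintype κ]

lemma dotProduct_self_nonneg (u : ι → ℝ) : 0 ≤ u ⬝ᵥ u :=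
  Finset.sum_nonneg fun i _ => mul_self_nonneg (u i)

lemma quadraticForm_nonneg {A : Matrix ι ι ℝ} (hA : A.PosSemidef) (u : ι → ℝ) :
    0 ≤ u ⬝ᵥ A *ᵥ u :=
  hA.dotProduct_mulVec_nonneg u

lemma dotProduct_mulVec_comm {A : Matrix ι ι ℝ} (hA : A.IsHermitian) (u v : ι → ℝ) :
    u ⬝ᵥ A *ᵥ v = v ⬝ᵥ A *ᵥ u := by
  rw [← Matrix.dotProduct_transpose_mulVec, ← Matrix.conjTranspose_eq_transpose_of_trivial, hA.eq]

lemma quadraticForm_smul (A : Matrix ι ι ℝ) (r : ℝ) (u : ι → ℝ) :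
    (r • u) ⬝ᵥ A *ᵥ (r • u) = r ^ 2 * (u ⬝ᵥ A *ᵥ u) := by
  rw [Matrix.mulVec_smul, smul_dotProduct, dotProduct_smul, smul_eq_mul, smul_eq_mul]
  ring

lemma quadraticForm_sub {A : Matrix ι ι ℝ} (hA : A.IsHermitian) (u v : ι → ℝ) :
    (u - v) ⬝ᵥ A *ᵥ (u - v) = u ⬝ᵥ A *ᵥ u - 2 * (u ⬝ᵥ A *ᵥ v) + v ⬝ᵥ A *ᵥ v := by
  rw [Matrix.mulVec_sub, dotProduct_sub, sub_dotProduct, sub_dotProduct,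
    dotProduct_mulVec_comm hA v u]
  ring

lemma le_quadraticForm_sub {A : Matrix ι ι ℝ} (hA : A.PosSemidef) {ρ : ℝ} (hρ : 0 < ρ)
    (u v : ι → ℝ) :
    (1 - ρ) * (u ⬝ᵥ A *ᵥ u) - ρ⁻¹ * (v ⬝ᵥ A *ᵥ v) ≤ (u - v) ⬝ᵥ A *ᵥ (u - v) := by
  have h := quadraticForm_nonneg hA (ρ • u - v)
  rw [quadraticForm_sub hA.1, quadraticForm_smul, smul_dotProduct, smul_eq_mul] at h
  have h' : 0 ≤ ρ * (u ⬝ᵥ A *ᵥ u) - 2 * (u ⬝ᵥ A *ᵥ v) + ρ⁻¹ * (v ⬝ᵥ A *ᵥ v) :=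
    (mul_nonneg (inv_pos.2 hρ).le h).trans_eq (by field_simp)
  rw [quadraticForm_sub hA.1]
  linarith [quadraticForm_nonneg hA v]

lemma quadraticForm_matrix_add (A B : Matrix ι ι ℝ) (u : ι → ℝ) :
    u ⬝ᵥ (A + B) *ᵥ u = u ⬝ᵥ A *ᵥ u + u ⬝ᵥ B *ᵥ u := by
  rw [Matrix.add_mulVec, dotProduct_add]

lemma quadraticForm_matrix_smul (r : ℝ) (A : Matrix ι ι ℝ) (u : ι → ℝ) :
    u ⬝ᵥ (r • A) *ᵥ u = r * (u ⬝ᵥ A *ᵥ u) := by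
  rw [Matrix.smul_mulVec, dotProduct_smul, smul_eq_mul]

lemma quadraticForm_conj (J : Matrix κ ι ℝ) (A : Matrix κ κ ℝ) (u : ι → ℝ) :
    u ⬝ᵥ (Jᵀ * A * J) *ᵥ u = (J *ᵥ u) ⬝ᵥ A *ᵥ (J *ᵥ u) := by
  rw [← Matrix.mulVec_mulVec, ← Matrix.mulVec_mulVec, Matrix.dotProduct_transpose_mulVec,
    dotProduct_comm]

lemma quadraticForm_gram (J : Matrix κ ι ℝ) (u : ι → ℝ) :
    u ⬝ᵥ (Jᵀ * J) *ᵥ u = (J *ᵥ u) ⬝ᵥ (J *ᵥ u) := by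
  rw [← Matrix.mulVec_mulVec, Matrix.dotProduct_transpose_mulVec]

lemma complete_square [DecidableEq ι] {A : Matrix ι ι ℝ} (hA : A.PosDef) (b x : ι → ℝ) :
    x ⬝ᵥ A *ᵥ x - 2 * (x ⬝ᵥ b) =
      (x - A⁻¹ *ᵥ b) ⬝ᵥ A *ᵥ (x - A⁻¹ *ᵥ b) - b ⬝ᵥ A⁻¹ *ᵥ b := by
  have h : A *ᵥ (A⁻¹ *ᵥ b) = b := by
    rw [Matrix.mulVec_mulVec, Matrix.mul_nonsing_inv _ hA.det_pos.ne'.isUnit, Matrix.one_mulVec]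
  rw [quadraticForm_sub hA.1, h, dotProduct_comm (A⁻¹ *ᵥ b) b]
  ring

lemma norm_sq_mulVec_le (A : Matrix κ ι ℝ) (u : ι → ℝ) :
    (A *ᵥ u) ⬝ᵥ (A *ᵥ u) ≤ (∑ l, A l ⬝ᵥ A l) * (u ⬝ᵥ u) := by
  rw [Finset.sum_mul]
  refine Finset.sum_le_sum fun l _ => ?_
  simpa only [Matrix.mulVec, dotProduct, sq] using
    Finset.sum_mul_sq_le_sq_mul_sq Finset.univ (A l) u

lemma exists_quadraticForm_le (A : Matrix ι ι ℝ) :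
    ∃ w : ℝ, 0 < w ∧ ∀ u : ι → ℝ, u ⬝ᵥ A *ᵥ u ≤ w * (u ⬝ᵥ u) := by
  have h0 : 0 ≤ ∑ l, A l ⬝ᵥ A l := Finset.sum_nonneg fun l _ => dotProduct_self_nonneg _
  refine ⟨1 / 2 * (1 + ∑ l, A l ⬝ᵥ A l), by linarith, fun u => ?_⟩
  have h1 := dotProduct_self_nonneg (u - A *ᵥ u)
  rw [sub_dotProduct, dotProduct_sub, dotProduct_sub, dotProduct_comm (A *ᵥ u) u] at h1
  linarith [norm_sq_mulVec_le A u]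

lemma exists_le_quadraticForm {A : Matrix ι ι ℝ} (hA : A.PosDef) :
    ∃ c : ℝ, 0 < c ∧ ∀ u : ι → ℝ, c * (u ⬝ᵥ u) ≤ u ⬝ᵥ A *ᵥ u := by
  classical
  obtain ⟨w, hw0, hw⟩ := exists_quadraticForm_le A⁻¹
  refine ⟨w⁻¹, inv_pos.2 hw0, fun u => ?_⟩
  have h := complete_square hA (w⁻¹ • u) u
  have h1 := quadraticForm_nonneg hA.posSemidef (u - A⁻¹ *ᵥ (w⁻¹ • u))
  have h2 : w⁻¹ ^ 2 * (u ⬝ᵥ A⁻¹ *ᵥ u) ≤ w⁻¹ * (u ⬝ᵥ u) := by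
    calc w⁻¹ ^ 2 * (u ⬝ᵥ A⁻¹ *ᵥ u) ≤ w⁻¹ ^ 2 * (w * (u ⬝ᵥ u)) := by gcongr; exact hw u
      _ = w⁻¹ * (u ⬝ᵥ u) := by field_simp
  rw [quadraticForm_smul, dotProduct_smul, smul_eq_mul] at h
  linarith

end QuadraticForm

/-! ### Gaussian and inverse gamma integrals -/

section Gaussian

variable {ι : Type*} [Fintype ι]

/-- The total mass `∫ exp (-yᵀ A y / 2) dy` of the unnormalised centred Gaussian density with
precision matrix `A`. -/
noncomputable def gaussMass (A : Matrix ι ι ℝ) : ℝ≥0∞ :=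
  ∫⁻ y : ι → ℝ, ENNReal.ofReal (Real.exp (-(1 / 2 * (y ⬝ᵥ A *ᵥ y))))

lemma continuous_quadraticForm (A : Matrix ι ι ℝ) :
    Continuous fun y : ι → ℝ => y ⬝ᵥ A *ᵥ y := by
  unfold dotProduct Matrix.mulVec dotProduct
  fun_prop

lemma lintegral_comp_smul_pi {r : ℝ} (hr : 0 < r) {f : (ι → ℝ) → ℝ≥0∞} (hf : Measurable f) :
    ∫⁻ y, f y = ENNReal.ofReal (r ^ Fintype.card ι) * ∫⁻ y, f (r • y) := by
  have hp : 0 < r ^ Fintype.card ι := pow_pos hr _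
  rw [← lintegral_map hf (measurable_const_smul r), Measure.map_addHaar_smul volume hr.ne',
    lintegral_smul_measure, Module.finrank_fintype_fun_eq_card, smul_eq_mul, ← mul_assoc,
    ← ENNReal.ofReal_mul hp.le, abs_of_pos (inv_pos.2 hp), mul_inv_cancel₀ hp.ne',
    ENNReal.ofReal_one, one_mul]

lemma lintegral_gauss_shift_scale (A : Matrix ι ι ℝ) (g : ι → ℝ) {ψ : ℝ} (hψ : 0 < ψ) :
    ∫⁻ y : ι → ℝ, ENNReal.ofReal (Real.exp (-(1 / 2 * ((y - g) ⬝ᵥ A *ᵥ (y - g))) / ψ)) =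
      ENNReal.ofReal (ψ ^ ((Fintype.card ι : ℝ) / 2)) * gaussMass A := by
  have hc : Measurable fun y : ι → ℝ =>
      ENNReal.ofReal (Real.exp (-(1 / 2 * (y ⬝ᵥ A *ᵥ y)) / ψ)) := by
    have := (continuous_quadraticForm A).measurable
    fun_prop
  rw [lintegral_sub_right_eq_self (fun y : ι → ℝ =>
      ENNReal.ofReal (Real.exp (-(1 / 2 * (y ⬝ᵥ A *ᵥ y)) / ψ))) g,
    lintegral_comp_smul_pi (Real.sqrt_pos.2 hψ) hc, gaussMass]
  congr 2
  · rw [Real.sqrt_eq_rpow, ← Real.rpow_natCast, ← Real.rpow_mul hψ.le]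
    ring_nf
  · funext y
    rw [quadraticForm_smul, Real.sq_sqrt hψ.le]
    congr 2
    field_simp

lemma gaussMass_ne_zero (A : Matrix ι ι ℝ) : gaussMass A ≠ 0 := by
  have hc := (continuous_quadraticForm A).measurable
  rw [gaussMass, Ne, lintegral_eq_zero_iff (by fun_prop)]
  intro h
  have : ∀ᵐ _ : ι → ℝ, False := h.mono fun y hy => by
    simpa using (ENNReal.ofReal_pos.2 (Real.exp_pos _)).ne' hy
  exact NeZero.ne (volume : Measure (ι → ℝ)) (by simpa [ae_iff] using this)

lemma gaussMass_ne_top {A : Matrix ι ι ℝ} (hA : A.PosDef) : gaussMass A ≠ ∞ := by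
  obtain ⟨c, hc, hcA⟩ := exists_le_quadraticForm hA
  have hi : Integrable fun y : ι → ℝ => ∏ i, Real.exp (-(c / 2) * y i ^ 2) :=
    Integrable.fintype_prod fun _ => integrable_exp_neg_mul_sq (half_pos hc)
  refine (lt_of_le_of_lt (lintegral_mono fun y => ENNReal.ofReal_le_ofReal ?_)
    hi.lintegral_lt_top).ne
  have e : y ⬝ᵥ y = ∑ i, y i ^ 2 := by simp only [dotProduct, sq]
  rw [← Real.exp_sum, Real.exp_le_exp, ← Finset.mul_sum, ← e]
  linarith [hcA y]

lemma gaussMass_le_of_le {A B : Matrix ι ι ℝ}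
    (h : ∀ y : ι → ℝ, y ⬝ᵥ A *ᵥ y ≤ y ⬝ᵥ B *ᵥ y) : gaussMass B ≤ gaussMass A :=
  lintegral_mono fun y => ENNReal.ofReal_le_ofReal (Real.exp_le_exp.2 (by linarith [h y]))

lemma gaussMass_le_mul_of_le {A B : Matrix ι ι ℝ} {t : ℝ} (ht : 0 < t)
    (h : ∀ y : ι → ℝ, y ⬝ᵥ B *ᵥ y ≤ t * (y ⬝ᵥ A *ᵥ y)) :
    gaussMass A ≤ ENNReal.ofReal (t ^ ((Fintype.card ι : ℝ) / 2)) * gaussMass B := by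
  rw [← lintegral_gauss_shift_scale B 0 ht]
  refine lintegral_mono fun y => ENNReal.ofReal_le_ofReal (Real.exp_le_exp.2 ?_)
  rw [sub_zero, neg_div, neg_le_neg_iff, div_le_iff₀ ht]
  linarith [h y]

end Gaussian

lemma lintegral_Ioi_eq_lintegral_Ioi_inv (f : ℝ → ℝ≥0∞) :
    ∫⁻ x in Set.Ioi (0 : ℝ), f x =
      ∫⁻ x in Set.Ioi (0 : ℝ), ENNReal.ofReal (x ^ (-2 : ℝ)) * f x⁻¹ := by
  have himg : (fun x : ℝ => x⁻¹) '' Set.Ioi 0 = Set.Ioi 0 := by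
    rw [Set.image_inv_eq_inv]
    exact Set.ext fun x => inv_pos (a := x)
  conv_lhs => rw [← himg]
  rw [lintegral_image_eq_lintegral_abs_deriv_mul (f' := fun x => -(x ^ 2)⁻¹) measurableSet_Ioi
    (fun x hx => (hasDerivAt_inv (ne_of_gt hx)).hasDerivWithinAt) inv_injective.injOn]
  refine setLIntegral_congr_fun measurableSet_Ioi fun x (hx : 0 < x) => ?_
  rw [abs_neg, abs_of_pos (by positivity), Real.rpow_neg hx.le, Real.rpow_two]

lemma lintegral_rpow_mul_exp_neg_div {a β : ℝ} (ha : 0 < a) (hβ : 0 < β) :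
    ∫⁻ ψ in Set.Ioi (0 : ℝ), ENNReal.ofReal (ψ ^ (-a - 1) * Real.exp (-β / ψ)) =
      ENNReal.ofReal (Real.Gamma a * β ^ (-a)) := by
  have hint : IntegrableOn (fun x : ℝ => x ^ (a - 1) * Real.exp (-(β * x))) (Set.Ioi 0) := by
    have := integrableOn_rpow_mul_exp_neg_mul_rpow (p := 1) (s := a - 1) (by linarith) one_pos hβ
    simpa only [Real.rpow_one, neg_mul] using this
  have hnonneg : 0 ≤ᵐ[volume.restrict (Set.Ioi (0 : ℝ))]
      fun x => x ^ (a - 1) * Real.exp (-(β * x)) := by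
    filter_upwards [self_mem_ae_restrict measurableSet_Ioi] with x (hx : 0 < x)
    simp only [Pi.zero_apply]
    positivity
  calc ∫⁻ ψ in Set.Ioi (0 : ℝ), ENNReal.ofReal (ψ ^ (-a - 1) * Real.exp (-β / ψ))
      = ∫⁻ x in Set.Ioi (0 : ℝ), ENNReal.ofReal (x ^ (a - 1) * Real.exp (-(β * x))) := by
        rw [lintegral_Ioi_eq_lintegral_Ioi_inv]
        refine setLIntegral_congr_fun measurableSet_Ioi fun x (hx : 0 < x) => ?_
        rw [← ENNReal.ofReal_mul (by positivity), div_inv_eq_mul, Real.inv_rpow hx.le,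
          ← Real.rpow_neg hx.le, ← mul_assoc, ← Real.rpow_add hx]
        ring_nf
    _ = ENNReal.ofReal (Real.Gamma a * β ^ (-a)) := by
        rw [← ofReal_integral_eq_lintegral_ofReal hint hnonneg,
          Real.integral_rpow_mul_exp_neg_mul_Ioi ha hβ, one_div, Real.inv_rpow hβ.le,
          ← Real.rpow_neg hβ.le, mul_comm]

section NormalInverseGamma

/-- The unnormalised density `ψ ^ (-α - 1) exp (-F γ / ψ)`, `ψ > 0`, of a pair `(γ, ψ)`; for a
quadratic function `F` it is a normal–inverse gamma density. -/
noncomputable def nigDensity {A : Type*} (α : ℝ) (F : A → ℝ) (θ : A × ℝ) : ℝ≥0∞ :=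
  ENNReal.ofReal (if 0 < θ.2 then θ.2 ^ (-α - 1) * Real.exp (-(F θ.1) / θ.2) else 0)

lemma measurable_nigDensity {A : Type*} [MeasurableSpace A] (α : ℝ) {F : A → ℝ}
    (hF : Measurable F) : Measurable (nigDensity α F) := by
  unfold nigDensity
  refine ENNReal.measurable_ofReal.comp (Measurable.ite ?_ ?_ measurable_const)
  · exact measurableSet_lt measurable_const measurable_snd
  · exact (measurable_snd.pow_const _).mul
      (Real.measurable_exp.comp ((hF.comp measurable_fst).neg.div measurable_snd))

lemma nigDensity_ne_top {A : Type*} (α : ℝ) (F : A → ℝ) (θ : A × ℝ) : nigDensity α F θ ≠ ∞ :=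
  ENNReal.ofReal_ne_top

lemma nigDensity_mul_nigDensity_eq_sq {A : Type*} {α₀ α₁ α₂ : ℝ} {F₀ F₁ F₂ : A → ℝ} {θ : A × ℝ}
    (hα : α₂ + α₀ = 2 * α₁) (hF : F₂ θ.1 + F₀ θ.1 = 2 * F₁ θ.1) :
    nigDensity α₂ F₂ θ * nigDensity α₀ F₀ θ = nigDensity α₁ F₁ θ ^ 2 := by
  unfold nigDensity
  split_ifs with h
  · rw [← ENNReal.ofReal_mul (by positivity), ← ENNReal.ofReal_pow (by positivity),
      mul_mul_mul_comm, ← Real.rpow_add h, ← Real.exp_add, mul_pow, ← Real.rpow_natCast,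
      ← Real.rpow_mul h.le, ← Real.exp_nat_mul, ← add_div, ← neg_add, hF]
    congr 3
    · push_cast
      linarith
    · push_cast
      ring
  · simp only [ENNReal.ofReal_zero, mul_zero, ne_eq, OfNat.ofNat_ne_zero, not_false_eq_true,
      zero_pow]

lemma lintegral_nigDensity_marginal {ι B : Type*} [Fintype ι] {F : B × (ι → ℝ) → ℝ}
    {H : B → ℝ} {A : Matrix ι ι ℝ} {g : B → ι → ℝ}
    (hF : ∀ c y, F (c, y) = H c + 1 / 2 * ((y - g c) ⬝ᵥ A *ᵥ (y - g c))) (α : ℝ) (θ : B × ℝ) :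
    ∫⁻ y, nigDensity (α + (Fintype.card ι : ℝ) / 2) F ((θ.1, y), θ.2) =
      gaussMass A * nigDensity α H θ := by
  obtain ⟨c, ψ⟩ := θ
  by_cases hψ : 0 < ψ
  · have hsplit : ∀ y, nigDensity (α + (Fintype.card ι : ℝ) / 2) F ((c, y), ψ) =
        ENNReal.ofReal (ψ ^ (-(α + (Fintype.card ι : ℝ) / 2) - 1) * Real.exp (-(H c) / ψ)) *
        ENNReal.ofReal (Real.exp (-(1 / 2 * ((y - g c) ⬝ᵥ A *ᵥ (y - g c))) / ψ)) := fun y => by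
      rw [nigDensity, if_pos hψ, ← ENNReal.ofReal_mul (by positivity), mul_assoc, ← Real.exp_add,
        hF, ← add_div, ← neg_add]
    simp only [hsplit]
    rw [lintegral_const_mul' _ _ ENNReal.ofReal_ne_top, lintegral_gauss_shift_scale A (g c) hψ,
      ← mul_assoc, ← ENNReal.ofReal_mul (by positivity), mul_comm, mul_right_comm,
      ← Real.rpow_add hψ, nigDensity, if_pos hψ]
    ring_nf
  · simp only [nigDensity, if_neg hψ, ENNReal.ofReal_zero, lintegral_zero, mul_zero]

lemma lintegral_nigDensity {ι : Type*} [Fintype ι] {a β : ℝ} {F : (ι → ℝ) → ℝ}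
    {A : Matrix ι ι ℝ} {g : ι → ℝ} (hF : ∀ γ, F γ = β + 1 / 2 * ((γ - g) ⬝ᵥ A *ᵥ (γ - g)))
    (ha : 0 < a) (hβ : 0 < β) :
    ∫⁻ θ, nigDensity (a + (Fintype.card ι : ℝ) / 2) F θ =
      gaussMass A * ENNReal.ofReal (Real.Gamma a * β ^ (-a)) := by
  have hF_meas : Measurable F := by
    rw [funext hF]
    have := (continuous_quadraticForm A).comp (continuous_id.sub (continuous_const (y := g)))
    exact (continuous_const.add (continuous_const.mul this)).measurable
  have hmarginal : ∀ ψ : ℝ, ∫⁻ γ, nigDensity (a + (Fintype.card ι : ℝ) / 2) F (γ, ψ) =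
      gaussMass A * (Set.Ioi (0 : ℝ)).indicator
        (fun ψ => ENNReal.ofReal (ψ ^ (-a - 1) * Real.exp (-β / ψ))) ψ := fun ψ => by
    refine (lintegral_nigDensity_marginal (B := Unit) (F := fun z => F z.2) (H := fun _ => β)
      (g := fun _ => g) (fun _ => hF) a ((), ψ)).trans ?_
    by_cases hψ : 0 < ψ <;> simp [nigDensity, hψ]
  rw [Measure.volume_eq_prod, lintegral_prod_symm _ (measurable_nigDensity _ hF_meas).aemeasurable,
    lintegral_congr hmarginal, lintegral_const_mul _ (Measurable.indicator (by fun_prop)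
      measurableSet_Ioi), lintegral_indicator measurableSet_Ioi,
    lintegral_rpow_mul_exp_neg_div ha hβ]

end NormalInverseGamma

/-! ### The energy of a node -/

section Energy

variable {ι κ : Type*} [Fintype κ] {τ : ℝ} {e : κ → ℝ} {J : Matrix κ ι ℝ} {S E : Matrix κ κ ℝ}

/-- The Hessian matrix of the quadratic function `energy` below. -/
def energyHessian [DecidableEq ι] (τ : ℝ) (J : Matrix κ ι ℝ) (S : Matrix κ κ ℝ) : Matrix ι ι ℝ :=
  τ • (1 : Matrix ι ι ℝ) + Jᵀ * S * J

lemma posDef_energyHessian [Finite ι] [DecidableEq ι] (hτ : 0 < τ) (hS : S.PosSemidef) :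
    (energyHessian τ J S).PosDef :=
  (Matrix.PosDef.one.smul hτ).add_posSemidef (posSemidef_conj hS J)

variable [Fintype ι]

lemma quadraticForm_energyHessian [DecidableEq ι] (w : ι → ℝ) :
    w ⬝ᵥ energyHessian τ J S *ᵥ w = τ * (w ⬝ᵥ w) + (J *ᵥ w) ⬝ᵥ S *ᵥ (J *ᵥ w) := by
  rw [energyHessian, quadraticForm_matrix_add, quadraticForm_matrix_smul, Matrix.one_mulVec,
    quadraticForm_conj]

/-- The exponent of the posterior density of the regression coefficients `γ` of a node, at
variance one: `S` is the Gram matrix of the data and `e - J γ` the coefficient vector of the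
residual. -/
noncomputable def energy (τ : ℝ) (e : κ → ℝ) (J : Matrix κ ι ℝ) (S : Matrix κ κ ℝ)
    (γ : ι → ℝ) : ℝ :=
  1 / 2 * (τ + τ * (γ ⬝ᵥ γ) + (e - J *ᵥ γ) ⬝ᵥ S *ᵥ (e - J *ᵥ γ))

lemma energy_add (γ : ι → ℝ) :
    energy τ e J (S + E) γ =
      energy τ e J S γ + 1 / 2 * ((e - J *ᵥ γ) ⬝ᵥ E *ᵥ (e - J *ᵥ γ)) := by
  rw [energy, energy, quadraticForm_matrix_add]
  ring

variable [DecidableEq ι]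

/-- The minimiser of `energy`. -/
noncomputable def energyArgmin (τ : ℝ) (e : κ → ℝ) (J : Matrix κ ι ℝ) (S : Matrix κ κ ℝ) : ι → ℝ :=
  (energyHessian τ J S)⁻¹ *ᵥ (Jᵀ *ᵥ (S *ᵥ e))

/-- The minimum of `energy`. -/
noncomputable def energyMin (τ : ℝ) (e : κ → ℝ) (J : Matrix κ ι ℝ) (S : Matrix κ κ ℝ) : ℝ :=
  energy τ e J S (energyArgmin τ e J S)

lemma energy_eq (hτ : 0 < τ) (hS : S.PosSemidef) (γ : ι → ℝ) :
    energy τ e J S γ = energyMin τ e J S + 1 / 2 * ((γ - energyArgmin τ e J S) ⬝ᵥ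
      energyHessian τ J S *ᵥ (γ - energyArgmin τ e J S)) := by
  set b : ι → ℝ := Jᵀ *ᵥ (S *ᵥ e) with hb
  have hexpand : ∀ x, energy τ e J S x =
      1 / 2 * (τ + e ⬝ᵥ S *ᵥ e + (x ⬝ᵥ energyHessian τ J S *ᵥ x - 2 * (x ⬝ᵥ b))) := fun x => by
    rw [energy, quadraticForm_sub hS.1, quadraticForm_energyHessian, hb,
      Matrix.dotProduct_transpose_mulVec, dotProduct_mulVec_comm hS.1 e (J *ᵥ x),
      dotProduct_comm (S *ᵥ e)]
    ring
  rw [energyMin, hexpand, hexpand, complete_square (posDef_energyHessian hτ hS) b γ,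
    complete_square (posDef_energyHessian hτ hS) b (energyArgmin τ e J S), energyArgmin, ← hb,
    sub_self, zero_dotProduct]
  ring

lemma energyMin_le_energy (hτ : 0 < τ) (hS : S.PosSemidef) (γ : ι → ℝ) :
    energyMin τ e J S ≤ energy τ e J S γ := by
  rw [energy_eq hτ hS γ]
  linarith [quadraticForm_nonneg (posDef_energyHessian (J := J) hτ hS).posSemidef
    (γ - energyArgmin τ e J S)]

lemma energyMin_pos (hτ : 0 < τ) (hS : S.PosSemidef) : 0 < energyMin τ e J S := by
  rw [energyMin, energy]
  have := mul_nonneg hτ.le (dotProduct_self_nonneg (energyArgmin τ e J S))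
  linarith [quadraticForm_nonneg hS (e - J *ᵥ energyArgmin τ e J S)]

lemma energyMin_le_energyMin_add (hτ : 0 < τ) (hS : S.PosSemidef) (hE : E.PosSemidef) :
    energyMin τ e J S ≤ energyMin τ e J (S + E) := by
  change _ ≤ energy τ e J (S + E) (energyArgmin τ e J (S + E))
  rw [energy_add]
  linarith [energyMin_le_energy (e := e) (J := J) hτ hS (energyArgmin τ e J (S + E)),
    quadraticForm_nonneg hE (e - J *ᵥ energyArgmin τ e J (S + E))]

/-- The value of the quadratic form `E` at the residual vector that minimises `energy` for `S`:
twice the first-order increment of `energyMin` in the direction `E`. -/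
noncomputable def energySlope (τ : ℝ) (e : κ → ℝ) (J : Matrix κ ι ℝ) (S E : Matrix κ κ ℝ) : ℝ :=
  (e - J *ᵥ energyArgmin τ e J S) ⬝ᵥ E *ᵥ (e - J *ᵥ energyArgmin τ e J S)

lemma energyMin_add_le (hτ : 0 < τ) (hS : S.PosSemidef) (hE : E.PosSemidef) :
    energyMin τ e J (S + E) ≤ energyMin τ e J S + energySlope τ e J S E / 2 := by
  refine (energyMin_le_energy hτ (hS.add hE) (energyArgmin τ e J S)).trans_eq ?_
  rw [energy_add, energyMin, energySlope]
  ring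

lemma energySlope_le {ρ : ℝ} (hτ : 0 < τ) (hρ : 0 ≤ ρ)
    (hES : ∀ u : κ → ℝ, u ⬝ᵥ E *ᵥ u ≤ ρ * (u ⬝ᵥ S *ᵥ u)) :
    energySlope τ e J S E ≤ 2 * ρ * energyMin τ e J S := by
  have := mul_nonneg hτ.le (dotProduct_self_nonneg (energyArgmin τ e J S))
  rw [energySlope, energyMin, energy]
  nlinarith [hES (e - J *ᵥ energyArgmin τ e J S)]

lemma le_energyMin_add {ρ : ℝ} (hτ : 0 < τ) (hS : S.PosSemidef) (hE : E.PosSemidef) (hρ : 0 < ρ)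
    (hES : ∀ u : κ → ℝ, u ⬝ᵥ E *ᵥ u ≤ ρ * (u ⬝ᵥ S *ᵥ u)) :
    energyMin τ e J S + (1 - ρ) * energySlope τ e J S E / 2 ≤ energyMin τ e J (S + E) := by
  set g := energyArgmin τ e J S
  set w := energyArgmin τ e J (S + E) - g
  set r := e - J *ᵥ g
  have hresidual : e - J *ᵥ energyArgmin τ e J (S + E) = r - J *ᵥ w := by
    simp only [r, w, Matrix.mulVec_sub]
    abel
  have hcurvature : ρ⁻¹ * ((J *ᵥ w) ⬝ᵥ E *ᵥ (J *ᵥ w)) ≤ w ⬝ᵥ energyHessian τ J S *ᵥ w := by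
    rw [quadraticForm_energyHessian, inv_mul_le_iff₀ hρ]
    have := mul_nonneg hρ.le (mul_nonneg hτ.le (dotProduct_self_nonneg w))
    linarith [hES (J *ᵥ w)]
  change _ ≤ energy τ e J (S + E) (energyArgmin τ e J (S + E))
  rw [energy_add, energy_eq hτ hS, hresidual, energySlope]
  linarith [le_quadraticForm_sub hE hρ r (J *ᵥ w)]

lemma energyMin_add_sq_le {ρ : ℝ} (hτ : 0 < τ) (hS : S.PosSemidef) (hE : E.PosSemidef)
    (hρ : 0 < ρ) (hES : ∀ u : κ → ℝ, u ⬝ᵥ E *ᵥ u ≤ ρ * (u ⬝ᵥ S *ᵥ u)) :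
    energyMin τ e J (S + E) ^ 2 ≤
      (1 + 5 * ρ ^ 2) * (energyMin τ e J S * energyMin τ e J (S + (2 : ℝ) • E)) := by
  have hE2 : ((2 : ℝ) • E).PosSemidef := hE.smul zero_le_two
  have hES2 : ∀ u : κ → ℝ, u ⬝ᵥ ((2 : ℝ) • E) *ᵥ u ≤ 2 * ρ * (u ⬝ᵥ S *ᵥ u) := fun u => by
    rw [quadraticForm_matrix_smul]
    linarith [hES u]
  have hslope2 : energySlope τ e J S ((2 : ℝ) • E) = 2 * energySlope τ e J S E :=
    quadraticForm_matrix_smul _ _ _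
  have hlower := le_energyMin_add (e := e) (J := J) hτ hS hE2 (mul_pos two_pos hρ) hES2
  have hupper := energyMin_add_le (e := e) (J := J) hτ hS hE
  have hslope := energySlope_le (e := e) (J := J) hτ hρ.le hES
  have hslope0 : 0 ≤ energySlope τ e J S E := quadraticForm_nonneg hE _
  have hmin := energyMin_pos (e := e) (J := J) hτ hS
  have hminB := energyMin_pos (e := e) (J := J) hτ (hS.add hE)
  have hmono := energyMin_le_energyMin_add (e := e) (J := J) hτ hS hE2
  rw [hslope2] at hlower
  generalize energyMin τ e J S = x at *
  generalize energyMin τ e J (S + E) = y at *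
  generalize energyMin τ e J (S + (2 : ℝ) • E) = z at *
  generalize energySlope τ e J S E = q at *
  have hxz : x ^ 2 + (1 - 2 * ρ) * q * x ≤ x * z := by nlinarith
  have hqx : ρ * q * x ≤ 2 * ρ ^ 2 * x ^ 2 := by nlinarith [mul_pos hρ hmin]
  have hqq : q ^ 2 ≤ 4 * ρ ^ 2 * x ^ 2 := by nlinarith
  calc y ^ 2 ≤ (x + q / 2) ^ 2 := by gcongr
    _ = x ^ 2 + (1 - 2 * ρ) * q * x + 2 * (ρ * q * x) + q ^ 2 / 4 := by ring
    _ ≤ x * z + 5 * ρ ^ 2 * x ^ 2 := by linarith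
    _ ≤ (1 + 5 * ρ ^ 2) * (x * z) := by nlinarith [mul_le_mul_of_nonneg_left hmono hmin.le]

lemma lintegral_nigDensity_energy (hτ : 0 < τ) (hS : S.PosSemidef) {a : ℝ} (ha : 0 < a) :
    ∫⁻ θ, nigDensity (a + (Fintype.card ι : ℝ) / 2) (energy τ e J S) θ =
      gaussMass (energyHessian τ J S) *
        ENNReal.ofReal (Real.Gamma a * energyMin τ e J S ^ (-a)) :=
  lintegral_nigDensity (energy_eq hτ hS) ha (energyMin_pos hτ hS)

lemma gaussMass_energyHessian_add_le (hE : E.PosSemidef) :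
    gaussMass (energyHessian τ J (S + E)) ≤ gaussMass (energyHessian τ J S) :=
  gaussMass_le_of_le fun w => by
    rw [quadraticForm_energyHessian, quadraticForm_energyHessian, quadraticForm_matrix_add]
    linarith [quadraticForm_nonneg hE (J *ᵥ w)]

lemma gaussMass_energyHessian_le {ρ : ℝ} (hτ : 0 < τ) (hρ : 0 < ρ)
    (hES : ∀ u : κ → ℝ, u ⬝ᵥ E *ᵥ u ≤ ρ * (u ⬝ᵥ S *ᵥ u)) :
    gaussMass (energyHessian τ J S) ≤ ENNReal.ofReal ((1 + ρ) ^ ((Fintype.card ι : ℝ) / 2)) *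
      gaussMass (energyHessian τ J (S + E)) :=
  gaussMass_le_mul_of_le (by positivity) fun w => by
    rw [quadraticForm_energyHessian, quadraticForm_energyHessian, quadraticForm_matrix_add]
    have := mul_nonneg hρ.le (mul_nonneg hτ.le (dotProduct_self_nonneg w))
    linarith [hES (J *ᵥ w)]

end Energy

/-! ### The chi-squared integral of a node -/

lemma Gamma_mul_Gamma_le {a s : ℝ} (ha : 1 < a) (hs : 0 ≤ s) :
    Real.Gamma (a + 2 * s) * Real.Gamma a ≤
      ((a + 2 * s) / (a - 1)) ^ s * Real.Gamma (a + s) ^ 2 := by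
  rcases hs.eq_or_lt with rfl | hs
  · simp [sq]
  have hlog_step : ∀ x : ℝ, 0 < x →
      Real.log (Real.Gamma (x + 1)) - Real.log (Real.Gamma x) = Real.log x := fun x hx => by
    rw [Real.Gamma_add_one hx.ne', Real.log_mul hx.ne' (Real.Gamma_pos_of_pos hx).ne',
      add_sub_cancel_right]
  have hupper := Real.convexOn_log_Gamma.slope_mono_adjacent
    (x := a + s) (y := a + 2 * s) (z := a + 2 * s + 1)
    (Set.mem_Ioi.2 (by linarith)) (Set.mem_Ioi.2 (by linarith)) (by linarith) (by linarith)
  have hlower := Real.convexOn_log_Gamma.slope_mono_adjacent (x := a - 1) (y := a) (z := a + s)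
    (Set.mem_Ioi.2 (by linarith)) (Set.mem_Ioi.2 (by linarith)) (by linarith) (by linarith)
  have hsub : a + 2 * s - (a + s) = s := by ring
  have hstep := hlog_step (a - 1) (by linarith)
  rw [sub_add_cancel] at hstep
  simp only [Function.comp_apply] at hupper hlower
  rw [add_sub_cancel_left, hsub, div_one, hlog_step _ (by linarith), div_le_iff₀ hs] at hupper
  rw [sub_sub_cancel, add_sub_cancel_left, div_one, hstep, le_div_iff₀ hs] at hlower
  have h0 : 0 < Real.Gamma a := Real.Gamma_pos_of_pos (by linarith)
  have : 0 < Real.Gamma (a + s) := Real.Gamma_pos_of_pos (by linarith)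
  have h2 : 0 < Real.Gamma (a + 2 * s) := Real.Gamma_pos_of_pos (by linarith)
  have hratio : 0 < (a + 2 * s) / (a - 1) := div_pos (by linarith) (by linarith)
  rw [← Real.log_le_log_iff (by positivity) (by positivity), Real.log_mul h2.ne' h0.ne',
    Real.log_mul (by positivity) (by positivity), Real.log_rpow hratio, Real.log_pow,
    Real.log_div (by linarith) (by linarith)]
  push_cast
  linarith

lemma rpow_mul_rpow_le_of_sq_le {a s c x y z : ℝ} (ha : 0 ≤ a) (hs : 0 ≤ s) (hc : 0 < c)
    (hx : 0 < x) (hy : 0 < y) (hyz : y ≤ z) (hsq : y ^ 2 ≤ c * (x * z)) :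
    z ^ (-(a + 2 * s)) * x ^ (-a) ≤ c ^ a * (y ^ (-(a + s))) ^ 2 := by
  have hz : 0 < z := hy.trans_le hyz
  have hlog := Real.log_le_log (by positivity) hsq
  have hlog' := Real.log_le_log hy hyz
  rw [Real.log_pow, Real.log_mul hc.ne' (by positivity), Real.log_mul hx.ne' hz.ne'] at hlog
  rw [← Real.log_le_log_iff (by positivity) (by positivity), Real.log_mul (by positivity)
    (by positivity), Real.log_mul (by positivity) (by positivity), Real.log_pow,
    Real.log_rpow hz, Real.log_rpow hx, Real.log_rpow hy, Real.log_rpow hc]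
  push_cast at hlog ⊢
  nlinarith [mul_le_mul_of_nonneg_left hlog ha, mul_le_mul_of_nonneg_left hlog' hs]

/-- A bound for the chi-squared integral of one node. Here `d` is the number of parents,
`a = (δ + n - m) / 2` and `a + s` are the inverse gamma shapes of the two posteriors, and `ρ`
is the relative difference of their Gram matrices. -/
noncomputable def nodeBound (ρ a s d : ℝ) : ℝ :=
  (1 + ρ) ^ (d / 2) * (((a + 2 * s) / (a - 1)) ^ s * Real.exp (5 * (a * ρ ^ 2)))

lemma Gamma_mul_rpow_mul_le {ρ a s x y z : ℝ} (ha : 1 < a) (hs : 0 ≤ s)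
    (hx : 0 < x) (hy : 0 < y) (hyz : y ≤ z) (hsq : y ^ 2 ≤ (1 + 5 * ρ ^ 2) * (x * z)) :
    Real.Gamma (a + 2 * s) * z ^ (-(a + 2 * s)) * (Real.Gamma a * x ^ (-a)) ≤
      ((a + 2 * s) / (a - 1)) ^ s * Real.exp (5 * (a * ρ ^ 2)) *
        (Real.Gamma (a + s) * y ^ (-(a + s))) ^ 2 := by
  have hz : 0 < z := hy.trans_le hyz
  have hexp : (1 + 5 * ρ ^ 2) ^ a ≤ Real.exp (5 * (a * ρ ^ 2)) := by
    calc (1 + 5 * ρ ^ 2) ^ a ≤ Real.exp (5 * ρ ^ 2) ^ a := by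
          gcongr
          linarith [Real.add_one_le_exp (5 * ρ ^ 2)]
      _ = _ := by rw [← Real.exp_mul]; ring_nf
  have hrpow := (rpow_mul_rpow_le_of_sq_le (by linarith) hs (by positivity) hx hy hyz hsq).trans
    (mul_le_mul_of_nonneg_right hexp (sq_nonneg (y ^ (-(a + s)))))
  have h0 : 0 < Real.Gamma a := Real.Gamma_pos_of_pos (by linarith)
  have h2 : 0 < Real.Gamma (a + 2 * s) := Real.Gamma_pos_of_pos (by linarith)
  calc Real.Gamma (a + 2 * s) * z ^ (-(a + 2 * s)) * (Real.Gamma a * x ^ (-a))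
      = Real.Gamma (a + 2 * s) * Real.Gamma a * (z ^ (-(a + 2 * s)) * x ^ (-a)) := by ring
    _ ≤ ((a + 2 * s) / (a - 1)) ^ s * Real.Gamma (a + s) ^ 2 *
        (Real.exp (5 * (a * ρ ^ 2)) * (y ^ (-(a + s))) ^ 2) :=
        mul_le_mul (Gamma_mul_Gamma_le ha hs) hrpow (by positivity)
          ((mul_pos h2 h0).le.trans (Gamma_mul_Gamma_le ha hs))
    _ = _ := by ring

section NodeBound

variable {ι κ : Type*} [Fintype ι] [Fintype κ] {τ ρ a s : ℝ} {J : Matrix κ ι ℝ}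
  {S E : Matrix κ κ ℝ}

lemma lintegral_nigDensity_energy_ne_zero {e : κ → ℝ} (hτ : 0 < τ)
    (hS : S.PosSemidef) (ha : 0 < a) :
    ∫⁻ θ, nigDensity (a + (Fintype.card ι : ℝ) / 2) (energy τ e J S) θ ≠ 0 := by
  classical
  have := Real.Gamma_pos_of_pos ha
  have := energyMin_pos (e := e) (J := J) hτ hS
  rw [lintegral_nigDensity_energy hτ hS ha]
  exact mul_ne_zero (gaussMass_ne_zero _) (ENNReal.ofReal_pos.2 (by positivity)).ne'

lemma lintegral_nigDensity_energy_ne_top {e : κ → ℝ} (hτ : 0 < τ)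
    (hS : S.PosSemidef) (ha : 0 < a) :
    ∫⁻ θ, nigDensity (a + (Fintype.card ι : ℝ) / 2) (energy τ e J S) θ ≠ ∞ := by
  classical
  rw [lintegral_nigDensity_energy hτ hS ha]
  exact ENNReal.mul_ne_top (gaussMass_ne_top (posDef_energyHessian hτ hS)) ENNReal.ofReal_ne_top

lemma lintegral_nigDensity_mul_le_nodeBound (e : κ → ℝ) (hτ : 0 < τ) (hS : S.PosSemidef)
    (hE : E.PosSemidef) (hρ : 0 < ρ) (hES : ∀ u : κ → ℝ, u ⬝ᵥ E *ᵥ u ≤ ρ * (u ⬝ᵥ S *ᵥ u))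
    (ha : 1 < a) (hs : 0 ≤ s) :
    (∫⁻ θ, nigDensity (a + 2 * s + (Fintype.card ι : ℝ) / 2)
        (energy τ e J (S + (2 : ℝ) • E)) θ) *
      (∫⁻ θ, nigDensity (a + (Fintype.card ι : ℝ) / 2) (energy τ e J S) θ) ≤
    ENNReal.ofReal (nodeBound ρ a s (Fintype.card ι)) *
      (∫⁻ θ, nigDensity (a + s + (Fintype.card ι : ℝ) / 2) (energy τ e J (S + E)) θ) ^ 2 := by
  classical
  have hE2 : S + (2 : ℝ) • E = S + E + E := by rw [two_smul, add_assoc]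
  have hS2 : (S + (2 : ℝ) • E).PosSemidef := hS.add (hE.smul zero_le_two)
  have hmass2 : gaussMass (energyHessian τ J (S + (2 : ℝ) • E)) ≤
      gaussMass (energyHessian τ J (S + E)) := hE2 ▸ gaussMass_energyHessian_add_le hE
  have hmass := gaussMass_energyHessian_le (J := J) hτ hρ hES
  have hx := energyMin_pos (e := e) (J := J) hτ hS
  have hy := energyMin_pos (e := e) (J := J) hτ (hS.add hE)
  have hz := energyMin_pos (e := e) (J := J) hτ hS2
  have hyz : energyMin τ e J (S + E) ≤ energyMin τ e J (S + (2 : ℝ) • E) :=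
    hE2 ▸ energyMin_le_energyMin_add hτ (hS.add hE) hE
  have hscalar := Gamma_mul_rpow_mul_le ha hs hx hy hyz (energyMin_add_sq_le hτ hS hE hρ hES)
  have : 0 < Real.Gamma (a + s) := Real.Gamma_pos_of_pos (by linarith)
  have : 0 < Real.Gamma (a + 2 * s) := Real.Gamma_pos_of_pos (by linarith)
  have : 0 < (a + 2 * s) / (a - 1) := div_pos (by linarith) (by linarith)
  rw [lintegral_nigDensity_energy hτ hS2 (by linarith), lintegral_nigDensity_energy hτ hS
    (by linarith), lintegral_nigDensity_energy hτ (hS.add hE) (by linarith), mul_mul_mul_comm,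
    ← ENNReal.ofReal_mul (by positivity)]
  refine (mul_le_mul' (mul_le_mul' hmass2 hmass) (ENNReal.ofReal_le_ofReal hscalar)).trans_eq ?_
  rw [nodeBound, ENNReal.ofReal_mul (p := (1 + ρ) ^ _) (by positivity),
    ENNReal.ofReal_mul (by positivity), ENNReal.ofReal_pow (by positivity)]
  ring

end NodeBound

/-! ### Least squares and residual contrasts -/

section Contrast

variable {n m k p : ℕ} {V : Matrix (Fin m) (Fin m) ℝ} {Q : Matrix (Fin n) (Fin m) ℝ}

lemma norm_sq_sub_mulVec (Q : Matrix (Fin n) (Fin m) ℝ) (r : Fin n → ℝ) (b : Fin m → ℝ) :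
    (r - Q *ᵥ b) ⬝ᵥ (r - Q *ᵥ b) =
      r ⬝ᵥ r + (b ⬝ᵥ (Qᵀ * Q) *ᵥ b - 2 * (b ⬝ᵥ (Qᵀ *ᵥ r))) := by
  rw [quadraticForm_gram, Matrix.dotProduct_transpose_mulVec, sub_dotProduct, dotProduct_sub,
    dotProduct_sub, dotProduct_comm r (Q *ᵥ b)]
  ring

lemma quadraticForm_one_sub_mul_mul_transpose (Q : Matrix (Fin n) (Fin m) ℝ)
    (W : Matrix (Fin m) (Fin m) ℝ) (r : Fin n → ℝ) :
    r ⬝ᵥ (1 - Q * W * Qᵀ) *ᵥ r = r ⬝ᵥ r - (Qᵀ *ᵥ r) ⬝ᵥ W *ᵥ (Qᵀ *ᵥ r) := by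
  have h := quadraticForm_conj Qᵀ W r
  rw [Matrix.transpose_transpose] at h
  rw [Matrix.sub_mulVec, Matrix.one_mulVec, dotProduct_sub, h]

lemma IsResidualContrast.isUnit_det {P : Matrix (Fin n) (Fin (n - m)) ℝ}
    (h : IsResidualContrast Q P) (hmn : m ≤ n) : IsUnit (Qᵀ * Q).det := by
  -- Otherwise `(Qᵀ Q)⁻¹ = 0`, so `P Pᵀ = 1` has trace `n`, while `Pᵀ P = 1` has trace `n - m`.
  by_contra hu
  have htrace := congrArg Matrix.trace h.2.2
  rw [Matrix.trace_mul_comm, h.2.1, Matrix.nonsing_inv_apply_not_isUnit _ hu, Matrix.mul_zero,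
    Matrix.zero_mul, sub_zero, Matrix.trace_one, Matrix.trace_one, Fintype.card_fin,
    Fintype.card_fin] at htrace
  have hcard : n - m = n := by exact_mod_cast htrace
  obtain rfl : m = 0 := by lia
  exact hu (by simp)

lemma IsResidualContrast.posDef_gram {P : Matrix (Fin n) (Fin (n - m)) ℝ}
    (h : IsResidualContrast Q P) (hmn : m ≤ n) : (Qᵀ * Q).PosDef :=
  (Matrix.posSemidef_conjTranspose_mul_self Q).posDef_iff_isUnit.2
    ((Matrix.isUnit_iff_isUnit_det _).2 (h.isUnit_det hmn))

/-- The least squares coefficients of the regression of `r` on the columns of `Q`; they are junk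
unless `Q` has full column rank. -/
noncomputable def leastSquares (Q : Matrix (Fin n) (Fin m) ℝ) (r : Fin n → ℝ) : Fin m → ℝ :=
  (Qᵀ * Q)⁻¹ *ᵥ (Qᵀ *ᵥ r)

lemma leastSquares_mulVec_add (hQ : (Qᵀ * Q).PosDef) (b : Fin m → ℝ) (r : Fin n → ℝ) :
    leastSquares Q (Q *ᵥ b + r) = b + leastSquares Q r := by
  rw [leastSquares, Matrix.mulVec_add, Matrix.mulVec_add, Matrix.mulVec_mulVec b Qᵀ,
    Matrix.mulVec_mulVec b, Matrix.nonsing_inv_mul _ hQ.det_pos.ne'.isUnit, Matrix.one_mulVec,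
    leastSquares]

variable {P : Matrix (Fin n) (Fin k) ℝ}

lemma IsResidualContrast.norm_sq_sub (h : IsResidualContrast Q P) (hQ : (Qᵀ * Q).PosDef)
    (r : Fin n → ℝ) (b : Fin m → ℝ) :
    (r - Q *ᵥ b) ⬝ᵥ (r - Q *ᵥ b) = (Pᵀ *ᵥ r) ⬝ᵥ (Pᵀ *ᵥ r) +
      (Q *ᵥ (b - leastSquares Q r)) ⬝ᵥ (Q *ᵥ (b - leastSquares Q r)) := by
  have hP : (Pᵀ *ᵥ r) ⬝ᵥ (Pᵀ *ᵥ r) = r ⬝ᵥ (P * Pᵀ) *ᵥ r := by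
    rw [← quadraticForm_gram, Matrix.transpose_transpose]
  rw [norm_sq_sub_mulVec, complete_square hQ, hP, h.2.2, quadraticForm_one_sub_mul_mul_transpose,
    ← quadraticForm_gram, leastSquares]
  ring

lemma IsResidualContrast.norm_sq_add (h : IsResidualContrast Q P) (hQ : (Qᵀ * Q).PosDef)
    (r : Fin n → ℝ) :
    (Pᵀ *ᵥ r) ⬝ᵥ (Pᵀ *ᵥ r) + (Q *ᵥ leastSquares Q r) ⬝ᵥ (Q *ᵥ leastSquares Q r) = r ⬝ᵥ r := by
  simpa [Matrix.mulVec_neg] using (h.norm_sq_sub hQ r 0).symm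

/-- The inverse covariance matrix `1 - Q (V⁻¹ + Qᵀ Q)⁻¹ Qᵀ`, up to the factor `ψ`, of the data
of a node after integrating out the effects of the exogenous variables. -/
noncomputable def marginalPrecision (V : Matrix (Fin m) (Fin m) ℝ) (Q : Matrix (Fin n) (Fin m) ℝ) :
    Matrix (Fin n) (Fin n) ℝ :=
  1 - Q * (V⁻¹ + Qᵀ * Q)⁻¹ * Qᵀ

lemma posDef_inv_add_gram (hV : V.PosDef) (Q : Matrix (Fin n) (Fin m) ℝ) :
    (V⁻¹ + Qᵀ * Q).PosDef :=
  hV.inv.add_posSemidef (Matrix.posSemidef_conjTranspose_mul_self Q)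

lemma marginalPrecision_complete_square (hV : V.PosDef) (Q : Matrix (Fin n) (Fin m) ℝ)
    (r : Fin n → ℝ) (b : Fin m → ℝ) :
    b ⬝ᵥ V⁻¹ *ᵥ b + (r - Q *ᵥ b) ⬝ᵥ (r - Q *ᵥ b) = r ⬝ᵥ marginalPrecision V Q *ᵥ r +
      (b - (V⁻¹ + Qᵀ * Q)⁻¹ *ᵥ (Qᵀ *ᵥ r)) ⬝ᵥ (V⁻¹ + Qᵀ * Q) *ᵥ
        (b - (V⁻¹ + Qᵀ * Q)⁻¹ *ᵥ (Qᵀ *ᵥ r)) := by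
  have h := complete_square (posDef_inv_add_gram hV Q) (Qᵀ *ᵥ r) b
  rw [quadraticForm_matrix_add] at h
  rw [norm_sq_sub_mulVec, marginalPrecision, quadraticForm_one_sub_mul_mul_transpose]
  linarith

lemma posSemidef_marginalPrecision (hV : V.PosDef) (Q : Matrix (Fin n) (Fin m) ℝ) :
    (marginalPrecision V Q).PosSemidef := by
  refine Matrix.PosSemidef.of_dotProduct_mulVec_nonneg (Matrix.isHermitian_one.sub
    (Matrix.isHermitian_mul_mul_conjTranspose Q (posDef_inv_add_gram hV Q).inv.1)) fun r => ?_
  set b := (V⁻¹ + Qᵀ * Q)⁻¹ *ᵥ (Qᵀ *ᵥ r) with hb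
  have hmin := marginalPrecision_complete_square hV Q r b
  rw [← hb, sub_self, zero_dotProduct, add_zero] at hmin
  rw [star_trivial, ← hmin]
  exact add_nonneg (quadraticForm_nonneg hV.inv.posSemidef b) (dotProduct_self_nonneg _)

lemma IsResidualContrast.norm_sq_le_marginalPrecision (h : IsResidualContrast Q P)
    (hQ : (Qᵀ * Q).PosDef) (hV : V.PosDef) (r : Fin n → ℝ) :
    (Pᵀ *ᵥ r) ⬝ᵥ (Pᵀ *ᵥ r) ≤ r ⬝ᵥ marginalPrecision V Q *ᵥ r := by
  set b := (V⁻¹ + Qᵀ * Q)⁻¹ *ᵥ (Qᵀ *ᵥ r) with hb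
  have hmin := marginalPrecision_complete_square hV Q r b
  rw [← hb, sub_self, zero_dotProduct, add_zero, h.norm_sq_sub hQ] at hmin
  linarith [quadraticForm_nonneg hV.inv.posSemidef b,
    dotProduct_self_nonneg (Q *ᵥ (b - leastSquares Q r))]

lemma IsResidualContrast.marginalPrecision_le (h : IsResidualContrast Q P)
    (hQ : (Qᵀ * Q).PosDef) (hV : V.PosDef) (r : Fin n → ℝ) :
    r ⬝ᵥ marginalPrecision V Q *ᵥ r ≤ (Pᵀ *ᵥ r) ⬝ᵥ (Pᵀ *ᵥ r) +
      leastSquares Q r ⬝ᵥ V⁻¹ *ᵥ leastSquares Q r := by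
  have hls := marginalPrecision_complete_square hV Q r (leastSquares Q r)
  rw [h.norm_sq_sub hQ, sub_self, Matrix.mulVec_zero, zero_dotProduct, add_zero] at hls
  linarith [quadraticForm_nonneg (posDef_inv_add_gram hV Q).posSemidef
    (leastSquares Q r - (V⁻¹ + Qᵀ * Q)⁻¹ *ᵥ (Qᵀ *ᵥ r))]

/-- The Gram matrix `Xᵀ P Pᵀ X` of the transformed data: the data enter the residual posterior
only through it. -/
def residualGram (P : Matrix (Fin n) (Fin k) ℝ) (X : Matrix (Fin n) (Fin p) ℝ) :
    Matrix (Fin p) (Fin p) ℝ :=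
  (Pᵀ * X)ᵀ * (Pᵀ * X)

/-- The weighted Gram matrix of the data: the data enter the Bayesian posterior of `Σ` only
through it. -/
noncomputable def bayesGram (V : Matrix (Fin m) (Fin m) ℝ) (Q : Matrix (Fin n) (Fin m) ℝ)
    (X : Matrix (Fin n) (Fin p) ℝ) : Matrix (Fin p) (Fin p) ℝ :=
  Xᵀ * marginalPrecision V Q * X

lemma quadraticForm_residualGram (P : Matrix (Fin n) (Fin k) ℝ) (X : Matrix (Fin n) (Fin p) ℝ)
    (u : Fin p → ℝ) :
    u ⬝ᵥ residualGram P X *ᵥ u = (Pᵀ *ᵥ (X *ᵥ u)) ⬝ᵥ (Pᵀ *ᵥ (X *ᵥ u)) := by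
  rw [residualGram, quadraticForm_gram, Matrix.mulVec_mulVec]

lemma posSemidef_residualGram (P : Matrix (Fin n) (Fin k) ℝ) (X : Matrix (Fin n) (Fin p) ℝ) :
    (residualGram P X).PosSemidef :=
  Matrix.posSemidef_conjTranspose_mul_self _

lemma posSemidef_bayesGram (hV : V.PosDef) (Q : Matrix (Fin n) (Fin m) ℝ)
    (X : Matrix (Fin n) (Fin p) ℝ) : (bayesGram V Q X).PosSemidef :=
  posSemidef_conj (posSemidef_marginalPrecision hV Q) X

lemma quadraticForm_bayesGram_sub_residualGram (V : Matrix (Fin m) (Fin m) ℝ)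
    (Q : Matrix (Fin n) (Fin m) ℝ) (P : Matrix (Fin n) (Fin k) ℝ) (X : Matrix (Fin n) (Fin p) ℝ)
    (u : Fin p → ℝ) :
    u ⬝ᵥ (bayesGram V Q X - residualGram P X) *ᵥ u =
      (X *ᵥ u) ⬝ᵥ marginalPrecision V Q *ᵥ (X *ᵥ u) - (Pᵀ *ᵥ (X *ᵥ u)) ⬝ᵥ (Pᵀ *ᵥ (X *ᵥ u)) := by
  rw [Matrix.sub_mulVec, dotProduct_sub, quadraticForm_residualGram, bayesGram, quadraticForm_conj]

lemma IsResidualContrast.posSemidef_bayesGram_sub_residualGram (h : IsResidualContrast Q P)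
    (hQ : (Qᵀ * Q).PosDef) (hV : V.PosDef) (X : Matrix (Fin n) (Fin p) ℝ) :
    (bayesGram V Q X - residualGram P X).PosSemidef := by
  refine Matrix.PosSemidef.of_dotProduct_mulVec_nonneg
    ((posSemidef_bayesGram hV Q X).1.sub (posSemidef_residualGram P X).1) fun u => ?_
  rw [star_trivial, quadraticForm_bayesGram_sub_residualGram]
  exact sub_nonneg.2 (h.norm_sq_le_marginalPrecision hQ hV _)

lemma IsResidualContrast.quadraticForm_bayesGram_sub_residualGram_le (h : IsResidualContrast Q P)
    (hQ : (Qᵀ * Q).PosDef) (hV : V.PosDef) (X : Matrix (Fin n) (Fin p) ℝ) (u : Fin p → ℝ) :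
    u ⬝ᵥ (bayesGram V Q X - residualGram P X) *ᵥ u ≤
      leastSquares Q (X *ᵥ u) ⬝ᵥ V⁻¹ *ᵥ leastSquares Q (X *ᵥ u) := by
  rw [quadraticForm_bayesGram_sub_residualGram]
  linarith [h.marginalPrecision_le hQ hV (X *ᵥ u)]

end Contrast

/-! ### The two posterior distributions -/

section NormalDensity

variable {ι A : Type*} [Fintype ι] [DecidableEq ι] {S : Matrix ι ι ℝ}

/-- The normalising constant of the normal distribution with covariance matrix `S`. -/
noncomputable def normalConst (S : Matrix ι ι ℝ) : ℝ :=
  (√((2 * Real.pi) ^ Fintype.card ι * S.det))⁻¹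

lemma normalConst_pos (hS : 0 < S.det) : 0 < normalConst S := by
  unfold normalConst
  positivity

lemma normalDensity_nonneg (μ : ι → ℝ) (S : Matrix ι ι ℝ) (x : ι → ℝ) :
    0 ≤ normalDensity μ S x := by
  unfold normalDensity
  positivity

lemma normalDensity_smul (hS : 0 < S.det) {t : ℝ} (ht : 0 < t) (μ x : ι → ℝ) :
    normalDensity μ (t • S) x = normalConst S * t ^ (-((Fintype.card ι : ℝ) / 2)) *
      Real.exp (-(1 / 2 * ((x - μ) ⬝ᵥ S⁻¹ *ᵥ (x - μ))) / t) := by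
  have hinv : (t • S)⁻¹ = t⁻¹ • S⁻¹ :=
    Matrix.inv_smul' (A := S) (k := Units.mk0 t ht.ne') hS.ne'.isUnit
  have hconst : (√(t ^ Fintype.card ι))⁻¹ = t ^ (-((Fintype.card ι : ℝ) / 2)) := by
    rw [Real.sqrt_eq_rpow, ← Real.rpow_natCast, ← Real.rpow_mul ht.le, ← Real.rpow_neg ht.le]
    ring_nf
  rw [normalDensity, normalConst, Matrix.det_smul, mul_left_comm, Real.sqrt_mul (by positivity),
    mul_inv, hconst, hinv, quadraticForm_matrix_smul, mul_comm (t ^ _)]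
  congr 2
  field_simp

lemma nigDensity_mul_normalDensity (hS : 0 < S.det) (α : ℝ) (F : A → ℝ) (μ x : A → ι → ℝ)
    (θ : A × ℝ) :
    nigDensity α F θ * ENNReal.ofReal (normalDensity (μ θ.1) (θ.2 • S) (x θ.1)) =
      ENNReal.ofReal (normalConst S) * nigDensity (α + (Fintype.card ι : ℝ) / 2)
        (fun a => F a + 1 / 2 * ((x a - μ a) ⬝ᵥ S⁻¹ *ᵥ (x a - μ a))) θ := by
  unfold nigDensity
  split_ifs with hψ
  · have hpow : θ.2 ^ (-(α + (Fintype.card ι : ℝ) / 2) - 1) =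
        θ.2 ^ (-α - 1) * θ.2 ^ (-((Fintype.card ι : ℝ) / 2)) := by
      rw [← Real.rpow_add hψ]
      ring_nf
    rw [← ENNReal.ofReal_mul (by positivity), ← ENNReal.ofReal_mul (normalConst_pos hS).le,
      normalDensity_smul hS hψ, hpow, neg_add (F θ.1), add_div (-F θ.1), Real.exp_add]
    congr 1
    ring
  · simp

lemma invGammaDensity_nonneg {a β : ℝ} (ha : 0 < a) (hβ : 0 < β) (x : ℝ) :
    0 ≤ invGammaDensity a β x := by
  have := Real.Gamma_pos_of_pos ha
  unfold invGammaDensity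
  split_ifs <;> positivity

lemma ofReal_invGammaDensity {a β : ℝ} (ha : 0 < a) (hβ : 0 < β) (θ : A × ℝ) :
    ENNReal.ofReal (invGammaDensity a β θ.2) =
      ENNReal.ofReal (β ^ a / Real.Gamma a) * nigDensity a (fun _ => β) θ := by
  have := Real.Gamma_pos_of_pos ha
  rw [nigDensity, ← ENNReal.ofReal_mul (by positivity), invGammaDensity, mul_ite, mul_zero,
    mul_assoc]

end NormalDensity

section Posterior

variable {p m n k : ℕ} (G : Digraph (Fin p))

/-- The matrix of the inclusion `ℝ^{P_i} → ℝ^p` of the coordinates of the parents of `i`. -/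
def parentEmb (i : Fin p) : Matrix (Fin p) (Parents G i) ℝ :=
  (1 : Matrix (Fin p) (Fin p) ℝ).submatrix id Subtype.val

variable [DecidableRel G.Adj]

lemma col_sub_parentData_mulVec (X : Matrix (Fin n) (Fin p) ℝ) (i : Fin p) (γ : Parents G i → ℝ) :
    X.col i - parentData G X i *ᵥ γ = X *ᵥ (Pi.single i 1 - parentEmb G i *ᵥ γ) := by
  have hdata : parentData G X i = X * parentEmb G i := by
    ext t j
    simp [parentData, parentEmb, Matrix.mul_apply, Matrix.one_apply]
  rw [hdata, ← Matrix.mulVec_mulVec, Matrix.mulVec_sub, Matrix.mulVec_single_one]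

/-- The unnormalised density of `(γ_i, ψ_i)` in a conjugate posterior: `a` is the shape of the
marginal distribution of `ψ_i` and `S` the Gram matrix through which the data enter. -/
noncomputable def nodeDensity (a τ : ℝ) (S : Matrix (Fin p) (Fin p) ℝ) (i : Fin p) :
    (Parents G i → ℝ) × ℝ → ℝ≥0∞ :=
  nigDensity (a + (Fintype.card (Parents G i) : ℝ) / 2)
    (energy τ (Pi.single i 1) (parentEmb G i) S)

/-- The shape of the posterior distribution of `ψ_i` given `n` observations. -/
noncomputable def nodeShape (δ : ℝ) (n : ℕ) (i : Fin p) : ℝ :=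
  (δ + Fintype.card (Parents G i) + n) / 2

lemma nodeShape_pos {δ : ℝ} (hδ : 0 < δ) (n : ℕ) (i : Fin p) : 0 < nodeShape G δ n i := by
  unfold nodeShape
  positivity

lemma nodeShape_add (δ : ℝ) (n m : ℕ) (i : Fin p) :
    nodeShape G δ (n + m) i = nodeShape G δ n i + (m : ℝ) / 2 := by
  unfold nodeShape
  push_cast
  ring

lemma measurable_energy {ι κ : Type*} [Fintype ι] [Fintype κ] (τ : ℝ) (e : κ → ℝ)
    (J : Matrix κ ι ℝ) (S : Matrix κ κ ℝ) : Measurable (energy τ e J S) := by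
  have hres : Continuous fun γ : ι → ℝ => e - J *ᵥ γ :=
    continuous_const.sub (continuous_const.matrix_mulVec continuous_id)
  exact (continuous_const.mul ((continuous_const.add (continuous_const.mul
    (continuous_id.dotProduct continuous_id))).add
      ((continuous_quadraticForm S).comp hres))).measurable

lemma measurable_nodeDensity (a τ : ℝ) (S : Matrix (Fin p) (Fin p) ℝ) (i : Fin p) :
    Measurable (nodeDensity G a τ S i) :=
  measurable_nigDensity _ (measurable_energy _ _ _ _)

lemma nodePrior_nonneg {δ τ : ℝ} (hδ : 0 < δ) (hτ : 0 < τ) (i : Fin p)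
    (θ : (Parents G i → ℝ) × ℝ) : 0 ≤ nodePrior G δ τ i θ :=
  mul_nonneg (normalDensity_nonneg _ _ _)
    (invGammaDensity_nonneg (by positivity) (by positivity) _)

lemma ofReal_nodePrior_eq {δ τ : ℝ} (hδ : 0 < δ) (hτ : 0 < τ) (i : Fin p) :
    ∃ c : ℝ≥0∞, c ≠ 0 ∧ c ≠ ∞ ∧ ∀ θ : (Parents G i → ℝ) × ℝ,
      ENNReal.ofReal (nodePrior G δ τ i θ) =
        c * nigDensity (nodeShape G δ 0 i + (Fintype.card (Parents G i) : ℝ) / 2)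
          (fun γ => 1 / 2 * (τ + τ * (γ ⬝ᵥ γ))) θ := by
  set S : Matrix (Parents G i) (Parents G i) ℝ := τ⁻¹ • 1 with hS_def
  have hS : 0 < S.det := by
    rw [hS_def, Matrix.det_smul, Matrix.det_one]
    positivity
  have hS_inv : S⁻¹ = τ • 1 := by
    refine Matrix.inv_eq_left_inv ?_
    rw [hS_def, smul_mul_smul_comm, mul_inv_cancel₀ hτ.ne', one_mul, one_smul]
  have ha : 0 < (δ + Fintype.card (Parents G i)) / 2 := by positivity
  have := Real.Gamma_pos_of_pos ha
  have hconst := normalConst_pos hS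
  refine ⟨ENNReal.ofReal ((τ / 2) ^ ((δ + Fintype.card (Parents G i)) / 2) /
      Real.Gamma ((δ + Fintype.card (Parents G i)) / 2)) * ENNReal.ofReal (normalConst S),
    mul_ne_zero (ENNReal.ofReal_pos.2 (by positivity)).ne' (ENNReal.ofReal_pos.2 hconst).ne',
    ENNReal.mul_ne_top ENNReal.ofReal_ne_top ENNReal.ofReal_ne_top, fun θ => ?_⟩
  have hmul := nigDensity_mul_normalDensity hS ((δ + Fintype.card (Parents G i)) / 2)
    (fun _ => τ / 2) (fun _ => 0) id θ
  rw [nodePrior, mul_comm τ⁻¹, mul_smul, mul_comm (normalDensity _ _ _),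
    ENNReal.ofReal_mul (invGammaDensity_nonneg ha (by positivity) _),
    ofReal_invGammaDensity ha (by positivity) θ, mul_assoc, mul_assoc, ← hS_def]
  refine congrArg _ (hmul.trans ?_)
  congr 2
  · simp [nodeShape]
  · funext γ
    rw [hS_inv, id, sub_zero, quadraticForm_matrix_smul, Matrix.one_mulVec]
    ring

lemma ofReal_residualNode_eq {δ τ : ℝ} (hδ : 0 < δ) (hτ : 0 < τ) (P : Matrix (Fin n) (Fin k) ℝ)
    (X : Matrix (Fin n) (Fin p) ℝ) (i : Fin p) :
    ∃ c : ℝ≥0∞, c ≠ 0 ∧ c ≠ ∞ ∧ ∀ θ : (Parents G i → ℝ) × ℝ,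
      ENNReal.ofReal (nodePrior G δ τ i θ *
        normalDensity ((Pᵀ * parentData G X i) *ᵥ θ.1) (θ.2 • (1 : Matrix (Fin k) (Fin k) ℝ))
          (Pᵀ *ᵥ X.col i)) =
      c * nodeDensity G (nodeShape G δ k i) τ (residualGram P X) i θ := by
  obtain ⟨c, hc0, hc1, hc⟩ := ofReal_nodePrior_eq G hδ hτ i
  have hI : 0 < (1 : Matrix (Fin k) (Fin k) ℝ).det := by simp
  refine ⟨c * ENNReal.ofReal (normalConst (1 : Matrix (Fin k) (Fin k) ℝ)),
    mul_ne_zero hc0 (ENNReal.ofReal_pos.2 (normalConst_pos hI)).ne',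
    ENNReal.mul_ne_top hc1 ENNReal.ofReal_ne_top, fun θ => ?_⟩
  rw [ENNReal.ofReal_mul (nodePrior_nonneg G hδ hτ i θ), hc, mul_assoc, mul_assoc]
  refine congrArg _ ((nigDensity_mul_normalDensity hI _ _
    (fun γ => (Pᵀ * parentData G X i) *ᵥ γ) (fun _ => Pᵀ *ᵥ X.col i) θ).trans ?_)
  have hshape : nodeShape G δ k i = nodeShape G δ 0 i + (k : ℝ) / 2 := by
    simpa only [zero_add] using nodeShape_add G δ 0 k i
  rw [nodeDensity, hshape, Fintype.card_fin, add_right_comm]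
  congr 2
  funext γ
  rw [inv_one, Matrix.one_mulVec, ← Matrix.mulVec_mulVec, ← Matrix.mulVec_sub,
    col_sub_parentData_mulVec, energy, quadraticForm_residualGram]
  ring

/-- The exponent of the joint posterior density of `(γ_i, b_i)` at variance one in the Bayesian
approach. -/
noncomputable def jointEnergy (τ : ℝ) (V : Matrix (Fin m) (Fin m) ℝ) (Q : Matrix (Fin n) (Fin m) ℝ)
    (X : Matrix (Fin n) (Fin p) ℝ) (i : Fin p) (z : (Parents G i → ℝ) × (Fin m → ℝ)) : ℝ :=
  1 / 2 * (τ + τ * (z.1 ⬝ᵥ z.1)) + 1 / 2 * (z.2 ⬝ᵥ V⁻¹ *ᵥ z.2) +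
    1 / 2 * ((X *ᵥ (Pi.single i 1 - parentEmb G i *ᵥ z.1) - Q *ᵥ z.2) ⬝ᵥ
      (X *ᵥ (Pi.single i 1 - parentEmb G i *ᵥ z.1) - Q *ᵥ z.2))

lemma measurable_jointEnergy (τ : ℝ) (V : Matrix (Fin m) (Fin m) ℝ) (Q : Matrix (Fin n) (Fin m) ℝ)
    (X : Matrix (Fin n) (Fin p) ℝ) (i : Fin p) : Measurable (jointEnergy G τ V Q X i) := by
  have hres : Continuous fun z : (Parents G i → ℝ) × (Fin m → ℝ) =>
      X *ᵥ (Pi.single i 1 - parentEmb G i *ᵥ z.1) - Q *ᵥ z.2 :=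
    (continuous_const.matrix_mulVec (continuous_const.sub
      (continuous_const.matrix_mulVec continuous_fst))).sub
      (continuous_const.matrix_mulVec continuous_snd)
  have hprior : Continuous fun z : (Parents G i → ℝ) × (Fin m → ℝ) => τ + τ * (z.1 ⬝ᵥ z.1) :=
    continuous_const.add (continuous_const.mul (continuous_fst.dotProduct continuous_fst))
  exact (((continuous_const.mul hprior).add (continuous_const.mul
    ((continuous_quadraticForm V⁻¹).comp continuous_snd))).add
      (continuous_const.mul (hres.dotProduct hres))).measurable

lemma jointEnergy_eq {V : Matrix (Fin m) (Fin m) ℝ} (hV : V.PosDef) (τ : ℝ)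
    (Q : Matrix (Fin n) (Fin m) ℝ) (X : Matrix (Fin n) (Fin p) ℝ) (i : Fin p)
    (γ : Parents G i → ℝ) (b : Fin m → ℝ) :
    jointEnergy G τ V Q X i (γ, b) =
      energy τ (Pi.single i 1) (parentEmb G i) (bayesGram V Q X) γ +
      1 / 2 * ((b - (V⁻¹ + Qᵀ * Q)⁻¹ *ᵥ
          (Qᵀ *ᵥ (X *ᵥ (Pi.single i 1 - parentEmb G i *ᵥ γ)))) ⬝ᵥ
        (V⁻¹ + Qᵀ * Q) *ᵥ (b - (V⁻¹ + Qᵀ * Q)⁻¹ *ᵥ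
          (Qᵀ *ᵥ (X *ᵥ (Pi.single i 1 - parentEmb G i *ᵥ γ))))) := by
  rw [jointEnergy, add_assoc, ← mul_add, marginalPrecision_complete_square hV, energy, bayesGram,
    quadraticForm_conj]
  ring

/-- The unnormalised joint posterior density of `((γ_i, ψ_i), b_i)` in the Bayesian approach. -/
noncomputable def jointDensity (a τ : ℝ) (V : Matrix (Fin m) (Fin m) ℝ)
    (Q : Matrix (Fin n) (Fin m) ℝ) (X : Matrix (Fin n) (Fin p) ℝ) (i : Fin p)
    (θ : ((Parents G i → ℝ) × ℝ) × (Fin m → ℝ)) : ℝ≥0∞ :=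
  nigDensity (a + (Fintype.card (Parents G i) : ℝ) / 2 + (m : ℝ) / 2) (jointEnergy G τ V Q X i)
    ((θ.1.1, θ.2), θ.1.2)

lemma measurable_jointDensity (a τ : ℝ) (V : Matrix (Fin m) (Fin m) ℝ)
    (Q : Matrix (Fin n) (Fin m) ℝ) (X : Matrix (Fin n) (Fin p) ℝ) (i : Fin p) :
    Measurable (jointDensity G a τ V Q X i) :=
  (measurable_nigDensity _ (measurable_jointEnergy G τ V Q X i)).comp (by fun_prop)

lemma lintegral_jointDensity {V : Matrix (Fin m) (Fin m) ℝ} (hV : V.PosDef) (a τ : ℝ)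
    (Q : Matrix (Fin n) (Fin m) ℝ) (X : Matrix (Fin n) (Fin p) ℝ) (i : Fin p)
    (θ : (Parents G i → ℝ) × ℝ) :
    ∫⁻ b, jointDensity G a τ V Q X i (θ, b) =
      gaussMass (V⁻¹ + Qᵀ * Q) * nodeDensity G a τ (bayesGram V Q X) i θ := by
  have h := lintegral_nigDensity_marginal (jointEnergy_eq G hV τ Q X i)
    (a + (Fintype.card (Parents G i) : ℝ) / 2) θ
  rwa [Fintype.card_fin] at h

lemma ofReal_bayesNode_eq {δ τ : ℝ} (hδ : 0 < δ) (hτ : 0 < τ) {V : Matrix (Fin m) (Fin m) ℝ}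
    (hV : V.PosDef) (Q : Matrix (Fin n) (Fin m) ℝ) (X : Matrix (Fin n) (Fin p) ℝ) (i : Fin p) :
    ∃ c : ℝ≥0∞, c ≠ 0 ∧ c ≠ ∞ ∧ ∀ θ : ((Parents G i → ℝ) × ℝ) × (Fin m → ℝ),
      ENNReal.ofReal (nodePrior G δ τ i θ.1 * normalDensity 0 (θ.1.2 • V) θ.2 *
        normalDensity (parentData G X i *ᵥ θ.1.1 + Q *ᵥ θ.2)
          (θ.1.2 • (1 : Matrix (Fin n) (Fin n) ℝ)) (X.col i)) =
      c * jointDensity G (nodeShape G δ n i) τ V Q X i θ := by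
  obtain ⟨c, hc0, hc1, hc⟩ := ofReal_nodePrior_eq G hδ hτ i
  have hI : 0 < (1 : Matrix (Fin n) (Fin n) ℝ).det := by simp
  refine ⟨c * (ENNReal.ofReal (normalConst V) *
      ENNReal.ofReal (normalConst (1 : Matrix (Fin n) (Fin n) ℝ))),
    mul_ne_zero hc0 (mul_ne_zero (ENNReal.ofReal_pos.2 (normalConst_pos hV.det_pos)).ne'
      (ENNReal.ofReal_pos.2 (normalConst_pos hI)).ne'),
    ENNReal.mul_ne_top hc1 (ENNReal.mul_ne_top ENNReal.ofReal_ne_top ENNReal.ofReal_ne_top), ?_⟩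
  rintro ⟨⟨γ, ψ⟩, b⟩
  have hprior := nigDensity_mul_normalDensity hV.det_pos
    (nodeShape G δ 0 i + (Fintype.card (Parents G i) : ℝ) / 2)
    (fun z : (Parents G i → ℝ) × (Fin m → ℝ) => 1 / 2 * (τ + τ * (z.1 ⬝ᵥ z.1)))
    (fun _ => 0) Prod.snd ((γ, b), ψ)
  have hlik := nigDensity_mul_normalDensity hI
    (nodeShape G δ 0 i + (Fintype.card (Parents G i) : ℝ) / 2 + (Fintype.card (Fin m) : ℝ) / 2)
    (fun z : (Parents G i → ℝ) × (Fin m → ℝ) => 1 / 2 * (τ + τ * (z.1 ⬝ᵥ z.1)) +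
      1 / 2 * ((z.2 - 0) ⬝ᵥ V⁻¹ *ᵥ (z.2 - 0)))
    (fun z => parentData G X i *ᵥ z.1 + Q *ᵥ z.2) (fun _ => X.col i) ((γ, b), ψ)
  have hshape : nodeShape G δ n i = nodeShape G δ 0 i + (n : ℝ) / 2 := by
    simpa only [zero_add] using nodeShape_add G δ 0 n i
  rw [ENNReal.ofReal_mul (mul_nonneg (nodePrior_nonneg G hδ hτ i _) (normalDensity_nonneg _ _ _)),
    ENNReal.ofReal_mul (nodePrior_nonneg G hδ hτ i _), hc, mul_assoc c, mul_assoc c, mul_assoc c]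
  refine congrArg (c * ·) ((congrArg (· * ENNReal.ofReal (normalDensity
    (parentData G X i *ᵥ γ + Q *ᵥ b) (ψ • (1 : Matrix (Fin n) (Fin n) ℝ)) (X.col i))) hprior).trans
    ?_)
  rw [mul_assoc, mul_assoc]
  refine congrArg _ (hlik.trans (congrArg _ ?_))
  rw [jointDensity, hshape, Fintype.card_fin, Fintype.card_fin]
  congr 1
  · ring
  · funext z
    rw [inv_one, Matrix.one_mulVec, sub_zero, ← sub_sub, col_sub_parentData_mulVec, jointEnergy]

lemma lintegral_nodeDensity_ne_zero {a τ : ℝ} (hτ : 0 < τ) {S : Matrix (Fin p) (Fin p) ℝ}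
    (hS : S.PosSemidef) (ha : 0 < a) (i : Fin p) : ∫⁻ θ, nodeDensity G a τ S i θ ≠ 0 :=
  lintegral_nigDensity_energy_ne_zero hτ hS ha

lemma lintegral_nodeDensity_ne_top {a τ : ℝ} (hτ : 0 < τ) {S : Matrix (Fin p) (Fin p) ℝ}
    (hS : S.PosSemidef) (ha : 0 < a) (i : Fin p) : ∫⁻ θ, nodeDensity G a τ S i θ ≠ ∞ :=
  lintegral_nigDensity_energy_ne_top hτ hS ha

lemma posterior_eq_pi {ι : Type*} [Fintype ι] {Θ : ι → Type*} [∀ i, MeasureSpace (Θ i)]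
    [∀ i, SigmaFinite (volume : Measure (Θ i))] {prior likelihood : (∀ i, Θ i) → ℝ}
    {c : ι → ℝ≥0∞} (hc₀ : ∀ i, c i ≠ 0) (hc₁ : ∀ i, c i ≠ ∞) {h : ∀ i, Θ i → ℝ≥0∞}
    (hh : ∀ i, Measurable (h i)) (h_zero : ∀ i, ∫⁻ x, h i x ≠ 0) (h_top : ∀ i, ∫⁻ x, h i x ≠ ∞)
    (hprod : ∀ θ, ENNReal.ofReal (prior θ * likelihood θ) = ∏ i, c i * h i (θ i)) :
    posterior prior likelihood = Measure.pi fun i => normalizedDensity (h i) := by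
  have hpost : posterior prior likelihood =
      normalizedDensity fun θ => (∏ i, c i) * ∏ i, h i (θ i) := by
    simp only [← Finset.prod_mul_distrib, ← hprod]
    rfl
  have hmeas : Measurable fun θ : ∀ i, Θ i => ∏ i, h i (θ i) :=
    Finset.measurable_prod _ fun i _ => (hh i).comp (measurable_pi_apply i)
  rw [hpost, pi_normalizedDensity hh h_zero h_top,
    normalizedDensity_const_mul hmeas (Finset.prod_ne_zero_iff.2 fun i _ => hc₀ i)
      (ENNReal.prod_ne_top fun i _ => hc₁ i)]

lemma measurable_covMatrix : Measurable (covMatrix G) := by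
  have hcoef : Continuous fun θ : Params G => 1 - coefMatrix G θ := by
    refine continuous_const.sub (continuous_matrix fun i j => ?_)
    simp only [coefMatrix, Matrix.of_apply]
    split_ifs <;> fun_prop
  have hinv : ∀ i j, Measurable fun θ : Params G => (1 - coefMatrix G θ)⁻¹ i j := fun i j => by
    simp only [Matrix.inv_def, Ring.inverse_eq_inv', Matrix.smul_apply, smul_eq_mul]
    exact hcoef.matrix_det.measurable.inv.mul (hcoef.matrix_adjugate.matrix_elem i j).measurable
  refine measurable_pi_iff.2 fun i => measurable_pi_iff.2 fun j => ?_
  simp only [covMatrix, Matrix.mul_apply (M := _ * _), Matrix.mul_diagonal, Matrix.transpose_apply]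
  exact Finset.measurable_sum _ fun l _ => ((hinv i l).mul (by fun_prop)).mul (hinv j l)

lemma residualPosteriorCov_eq {δ τ : ℝ} (hδ : 0 < δ) (hτ : 0 < τ) (P : Matrix (Fin n) (Fin k) ℝ)
    (X : Matrix (Fin n) (Fin p) ℝ) :
    residualPosteriorCov G δ τ P X = (Measure.pi fun i => normalizedDensity
      (nodeDensity G (nodeShape G δ k i) τ (residualGram P X) i)).map (covMatrix G) := by
  choose c hc₀ hc₁ hc using ofReal_residualNode_eq G hδ hτ P X
  rw [residualPosteriorCov, posterior_eq_pi hc₀ hc₁ (fun i => measurable_nodeDensity G _ _ _ i)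
    (fun i => lintegral_nodeDensity_ne_zero G hτ (posSemidef_residualGram P X)
      (nodeShape_pos G hδ k i) i)
    (fun i => lintegral_nodeDensity_ne_top G hτ (posSemidef_residualGram P X)
      (nodeShape_pos G hδ k i) i)]
  intro θ
  rw [residualPrior, residualLikelihood, ← Finset.prod_mul_distrib, ENNReal.ofReal_prod_of_nonneg
    fun i _ => mul_nonneg (nodePrior_nonneg G hδ hτ i _) (normalDensity_nonneg _ _ _)]
  exact Finset.prod_congr rfl fun i _ => hc i (θ i)

lemma map_fst_normalizedDensity_jointDensity {V : Matrix (Fin m) (Fin m) ℝ} (hV : V.PosDef)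
    (a τ : ℝ) (Q : Matrix (Fin n) (Fin m) ℝ) (X : Matrix (Fin n) (Fin p) ℝ) (i : Fin p) :
    (normalizedDensity (jointDensity G a τ V Q X i)).map Prod.fst =
      normalizedDensity (nodeDensity G a τ (bayesGram V Q X) i) := by
  rw [map_fst_normalizedDensity (measurable_jointDensity G a τ V Q X i)]
  simp_rw [lintegral_jointDensity G hV]
  exact normalizedDensity_const_mul (measurable_nodeDensity G _ _ _ i) (gaussMass_ne_zero _)
    (gaussMass_ne_top (posDef_inv_add_gram hV Q))

lemma lintegral_jointDensity_prod {V : Matrix (Fin m) (Fin m) ℝ} (hV : V.PosDef) (a τ : ℝ)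
    (Q : Matrix (Fin n) (Fin m) ℝ) (X : Matrix (Fin n) (Fin p) ℝ) (i : Fin p) :
    ∫⁻ θ, jointDensity G a τ V Q X i θ =
      gaussMass (V⁻¹ + Qᵀ * Q) * ∫⁻ θ, nodeDensity G a τ (bayesGram V Q X) i θ := by
  rw [Measure.volume_eq_prod, lintegral_prod _ (measurable_jointDensity G a τ V Q X i).aemeasurable]
  simp_rw [lintegral_jointDensity G hV]
  rw [lintegral_const_mul _ (measurable_nodeDensity G _ _ _ i)]

lemma bayesPosterior_eq_pi {δ τ : ℝ} (hδ : 0 < δ) (hτ : 0 < τ) {V : Matrix (Fin m) (Fin m) ℝ}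
    (hV : V.PosDef) (Q : Matrix (Fin n) (Fin m) ℝ) (X : Matrix (Fin n) (Fin p) ℝ) :
    posterior (bayesPrior G δ τ V) (bayesLikelihood G Q X) =
      Measure.pi fun i => normalizedDensity (jointDensity G (nodeShape G δ n i) τ V Q X i) := by
  choose c hc₀ hc₁ hc using ofReal_bayesNode_eq G hδ hτ hV Q X
  refine posterior_eq_pi hc₀ hc₁ (fun i => measurable_jointDensity G _ _ _ _ _ i) (fun i => ?_)
    (fun i => ?_) fun θ => ?_
  · rw [lintegral_jointDensity_prod G hV]
    exact mul_ne_zero (gaussMass_ne_zero _) (lintegral_nodeDensity_ne_zero G hτ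
      (posSemidef_bayesGram hV Q X) (nodeShape_pos G hδ n i) i)
  · rw [lintegral_jointDensity_prod G hV]
    exact ENNReal.mul_ne_top (gaussMass_ne_top (posDef_inv_add_gram hV Q))
      (lintegral_nodeDensity_ne_top G hτ (posSemidef_bayesGram hV Q X) (nodeShape_pos G hδ n i) i)
  · rw [bayesPrior, bayesLikelihood, ← Finset.prod_mul_distrib, ENNReal.ofReal_prod_of_nonneg
      fun i _ => mul_nonneg (mul_nonneg (nodePrior_nonneg G hδ hτ i _) (normalDensity_nonneg _ _ _))
        (normalDensity_nonneg _ _ _)]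
    exact Finset.prod_congr rfl fun i _ => hc i (θ i)

lemma isProbabilityMeasure_nodeDensity {a τ : ℝ} (hτ : 0 < τ) {S : Matrix (Fin p) (Fin p) ℝ}
    (hS : S.PosSemidef) (ha : 0 < a) (i : Fin p) :
    IsProbabilityMeasure (normalizedDensity (nodeDensity G a τ S i)) :=
  isProbabilityMeasure_normalizedDensity (lintegral_nodeDensity_ne_zero G hτ hS ha i)
    (lintegral_nodeDensity_ne_top G hτ hS ha i)

lemma bayesPosteriorCov_eq {δ τ : ℝ} (hδ : 0 < δ) (hτ : 0 < τ) {V : Matrix (Fin m) (Fin m) ℝ}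
    (hV : V.PosDef) (Q : Matrix (Fin n) (Fin m) ℝ) (X : Matrix (Fin n) (Fin p) ℝ) :
    bayesPosteriorCov G δ τ V Q X = (Measure.pi fun i => normalizedDensity
      (nodeDensity G (nodeShape G δ n i) τ (bayesGram V Q X) i)).map (covMatrix G) := by
  have hmap := fun i =>
    map_fst_normalizedDensity_jointDensity G hV (nodeShape G δ n i) τ Q X i
  have : ∀ i, IsProbabilityMeasure ((normalizedDensity
      (jointDensity G (nodeShape G δ n i) τ V Q X i)).map Prod.fst) := fun i => by
    rw [hmap]
    exact isProbabilityMeasure_nodeDensity G hτ (posSemidef_bayesGram hV Q X)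
      (nodeShape_pos G hδ n i) i
  have hfst : Measurable fun (θ : FullParams G m) i => (θ i).1 := by fun_prop
  change Measure.map (covMatrix G ∘ fun (θ : FullParams G m) i => (θ i).1) _ = _
  rw [← Measure.map_map (measurable_covMatrix G) hfst, bayesPosterior_eq_pi G hδ hτ hV,
    Measure.pi_map_pi fun i => measurable_fst.aemeasurable]
  simp_rw [hmap]

lemma nodeDensity_mul_nodeDensity_eq_sq (a s τ : ℝ) (S E : Matrix (Fin p) (Fin p) ℝ) (i : Fin p)
    (θ : (Parents G i → ℝ) × ℝ) :
    nodeDensity G (a + 2 * s) τ (S + (2 : ℝ) • E) i θ * nodeDensity G a τ S i θ =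
      nodeDensity G (a + s) τ (S + E) i θ ^ 2 := by
  refine nigDensity_mul_nigDensity_eq_sq (by ring) ?_
  simp only [energy, quadraticForm_matrix_add, quadraticForm_matrix_smul]
  ring

lemma klDiv_pi_nodeDensity_add_one_le {τ : ℝ} (hτ : 0 < τ) {S E : Matrix (Fin p) (Fin p) ℝ}
    (hS : S.PosSemidef) (hE : E.PosSemidef) {ρ : ℝ} (hρ : 0 < ρ)
    (hES : ∀ u, u ⬝ᵥ E *ᵥ u ≤ ρ * (u ⬝ᵥ S *ᵥ u)) {a : Fin p → ℝ} (ha : ∀ i, 1 < a i) {s : ℝ}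
    (hs : 0 ≤ s) :
    InformationTheory.klDiv
        (Measure.pi fun i => normalizedDensity (nodeDensity G (a i + s) τ (S + E) i))
        (Measure.pi fun i => normalizedDensity (nodeDensity G (a i) τ S i)) + 1 ≤
      ∏ i, ENNReal.ofReal (nodeBound ρ (a i) s (Fintype.card (Parents G i))) := by
  have ha₀ : ∀ i, 0 < a i := fun i => one_pos.trans (ha i)
  have hf₀ := fun i =>
    lintegral_nodeDensity_ne_zero G hτ (hS.add hE) (add_pos_of_pos_of_nonneg (ha₀ i) hs) i
  have hf₁ := fun i =>
    lintegral_nodeDensity_ne_top G hτ (hS.add hE) (add_pos_of_pos_of_nonneg (ha₀ i) hs) i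
  refine (klDiv_pi_normalizedDensity_add_one_le
    (fun i => measurable_nodeDensity G _ _ _ i) (fun i => measurable_nodeDensity G _ _ _ i)
    (fun i => measurable_nodeDensity G _ _ _ i)
    (fun i θ => nodeDensity_mul_nodeDensity_eq_sq G (a i) s τ S E i θ)
    (fun i θ => nigDensity_ne_top _ _ _) hf₀ hf₁
    (fun i => lintegral_nodeDensity_ne_zero G hτ hS (ha₀ i) i)
    (fun i => lintegral_nodeDensity_ne_top G hτ hS (ha₀ i) i)).trans ?_
  refine Finset.prod_le_prod' fun i _ => ?_
  rw [← div_eq_mul_inv]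
  exact ENNReal.div_le_of_le_mul
    (lintegral_nigDensity_mul_le_nodeBound _ hτ hS hE hρ hES (ha i) hs)

lemma covDivergence_add_one_le {δ τ : ℝ} (hδ : 0 < δ) (hτ : 0 < τ) {V : Matrix (Fin m) (Fin m) ℝ}
    (hV : V.PosDef) {Q : Matrix (Fin n) (Fin m) ℝ} {P : Matrix (Fin n) (Fin (n - m)) ℝ}
    (h : IsResidualContrast Q P) (hmn : m ≤ n) (hn : 2 ≤ n - m) {X : Matrix (Fin n) (Fin p) ℝ}
    {ρ : ℝ} (hρ : 0 < ρ)
    (hBS : ∀ u, u ⬝ᵥ (bayesGram V Q X - residualGram P X) *ᵥ u ≤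
      ρ * (u ⬝ᵥ residualGram P X *ᵥ u)) :
    covDivergence G δ τ V Q P X + 1 ≤ ∏ i, ENNReal.ofReal
      (nodeBound ρ (nodeShape G δ (n - m) i) (m / 2) (Fintype.card (Parents G i))) := by
  have hshape : ∀ i, nodeShape G δ n i = nodeShape G δ (n - m) i + (m : ℝ) / 2 := fun i => by
    rw [← nodeShape_add, Nat.sub_add_cancel hmn]
  have hshape_gt : ∀ i, 1 < nodeShape G δ (n - m) i := fun i => by
    have hn' : (2 : ℝ) ≤ (n - m : ℕ) := by exact_mod_cast hn
    have : (0 : ℝ) ≤ Fintype.card (Parents G i) := Nat.cast_nonneg _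
    rw [nodeShape]
    linarith
  have hkl := klDiv_pi_nodeDensity_add_one_le G hτ (posSemidef_residualGram P X)
    (h.posSemidef_bayesGram_sub_residualGram (h.posDef_gram hmn) hV X) hρ hBS hshape_gt
    (s := m / 2) (by positivity)
  simp only [add_sub_cancel, ← hshape] at hkl
  have hprob_bayes := fun i => isProbabilityMeasure_nodeDensity G hτ
    (posSemidef_bayesGram hV Q X) (nodeShape_pos G hδ n i) i
  have hprob_residual := fun i => isProbabilityMeasure_nodeDensity G hτ
    (posSemidef_residualGram P X) (nodeShape_pos G hδ (n - m) i) i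
  rw [covDivergence, bayesPosteriorCov_eq G hδ hτ hV, residualPosteriorCov_eq G hδ hτ]
  exact (add_le_add_left
    (InformationTheory.klDiv_map_le _ _ (measurable_covMatrix G)) 1).trans hkl

end Posterior

/-! ### A criterion for convergence -/

lemma tendsto_nodeBound {ι : Type*} {l : Filter ι} {ρ a : ι → ℝ} (ha : Tendsto a l atTop)
    (hρ : Tendsto ρ l (𝓝 0)) (haρ : Tendsto (fun t => a t * ρ t ^ 2) l (𝓝 0)) (s d : ℝ) :
    Tendsto (fun t => nodeBound (ρ t) (a t) s d) l (𝓝 1) := by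
  have hdet : Tendsto (fun t => (1 + ρ t) ^ (d / 2)) l (𝓝 1) := by
    simpa using (hρ.const_add 1).rpow_const (p := d / 2) (Or.inl (by norm_num))
  have hratio : Tendsto (fun t => (a t + 2 * s) / (a t - 1)) l (𝓝 1) := by
    have hlim : Tendsto (fun t => 1 + (2 * s + 1) / (a t - 1)) l (𝓝 (1 + 0)) :=
      (tendsto_const_nhds.div_atTop (tendsto_atTop_add_const_right l (-1) ha)).const_add 1
    rw [add_zero] at hlim
    refine hlim.congr' ?_
    filter_upwards [ha.eventually_gt_atTop 1] with t ht
    have : a t - 1 ≠ 0 := (sub_pos.2 ht).ne'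
    field_simp
    ring
  have hgamma : Tendsto (fun t => ((a t + 2 * s) / (a t - 1)) ^ s) l (𝓝 1) := by
    simpa using hratio.rpow_const (p := s) (Or.inl one_ne_zero)
  have hexp : Tendsto (fun t => Real.exp (5 * (a t * ρ t ^ 2))) l (𝓝 1) := by
    simpa using (haρ.const_mul 5).rexp
  simpa [nodeBound] using hdet.mul (hgamma.mul hexp)

section Criterion

variable {p m : ℕ} (G : Digraph (Fin p)) [DecidableRel G.Adj]

lemma tendsto_nodeShape_sub (δ : ℝ) (m : ℕ) (i : Fin p) :
    Tendsto (fun n => nodeShape G δ (n - m) i) atTop atTop :=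
  (tendsto_atTop_add_const_left _ _
    (tendsto_natCast_atTop_atTop.comp (tendsto_sub_atTop_nat m))).atTop_div_const two_pos

lemma tendsto_nodeShape_mul_sq {δ : ℝ} (hδ : 0 < δ) (m : ℕ) (i : Fin p) {ρ : ℕ → ℝ}
    (hρ : Tendsto (fun n : ℕ => √n * ρ n) atTop (𝓝 0)) :
    Tendsto (fun n => nodeShape G δ (n - m) i * ρ n ^ 2) atTop (𝓝 0) := by
  have hlim : Tendsto (fun n : ℕ => (δ + Fintype.card (Parents G i) + 1) * (√n * ρ n) ^ 2) atTop
      (𝓝 0) := by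
    simpa using (hρ.pow 2).const_mul (δ + Fintype.card (Parents G i) + 1)
  refine squeeze_zero' (Eventually.of_forall fun n =>
    mul_nonneg (nodeShape_pos G hδ _ i).le (sq_nonneg _)) ?_ hlim
  filter_upwards [eventually_ge_atTop 1] with n hn
  have hn' : (1 : ℝ) ≤ n := by exact_mod_cast hn
  have hsub : ((n - m : ℕ) : ℝ) ≤ n := by exact_mod_cast Nat.sub_le n m
  have hcard : (0 : ℝ) ≤ Fintype.card (Parents G i) := Nat.cast_nonneg _
  rw [mul_pow, Real.sq_sqrt n.cast_nonneg, ← mul_assoc]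
  refine mul_le_mul_of_nonneg_right ?_ (sq_nonneg _)
  rw [nodeShape]
  nlinarith [mul_nonneg (add_nonneg hδ.le hcard) (sub_nonneg.2 hn')]

lemma tendsto_covDivergence {δ τ : ℝ} (hδ : 0 < δ) (hτ : 0 < τ) {V : Matrix (Fin m) (Fin m) ℝ}
    (hV : V.PosDef) {Q : (n : ℕ) → Matrix (Fin n) (Fin m) ℝ}
    {X : (n : ℕ) → Matrix (Fin n) (Fin p) ℝ} {P : (n : ℕ) → Matrix (Fin n) (Fin (n - m)) ℝ}
    (hP : ∀ᶠ n in atTop, IsResidualContrast (Q n) (P n)) {ρ : ℕ → ℝ}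
    (hρ_pos : ∀ᶠ n in atTop, 0 < ρ n) (hρ : Tendsto (fun n : ℕ => √n * ρ n) atTop (𝓝 0))
    (hls : ∀ᶠ n in atTop, ∀ u,
      leastSquares (Q n) (X n *ᵥ u) ⬝ᵥ leastSquares (Q n) (X n *ᵥ u) ≤
        ρ n * (((P n)ᵀ *ᵥ (X n *ᵥ u)) ⬝ᵥ ((P n)ᵀ *ᵥ (X n *ᵥ u)))) :
    Tendsto (fun n => covDivergence G δ τ V (Q n) (P n) (X n)) atTop (𝓝 0) := by
  obtain ⟨w, hw, hwV⟩ := exists_quadraticForm_le V⁻¹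
  have hwρ : Tendsto (fun n : ℕ => √n * (w * ρ n)) atTop (𝓝 0) := by
    simpa [mul_left_comm] using hρ.const_mul w
  have hwρ_zero : Tendsto (fun n => w * ρ n) atTop (𝓝 0) := by
    have hsqrt := Real.tendsto_sqrt_atTop.comp (tendsto_natCast_atTop_atTop (R := ℝ))
    refine (hwρ.div_atTop hsqrt).congr' ?_
    filter_upwards [eventually_gt_atTop 0] with n hn
    exact mul_div_cancel_left₀ _ (Real.sqrt_pos.2 (Nat.cast_pos.2 hn)).ne'
  have hbound : Tendsto (fun n => ∏ i, ENNReal.ofReal (nodeBound (w * ρ n)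
      (nodeShape G δ (n - m) i) (m / 2) (Fintype.card (Parents G i))) - 1) atTop (𝓝 0) := by
    have hnode := fun i => ENNReal.tendsto_ofReal (tendsto_nodeBound (tendsto_nodeShape_sub G δ m i)
      hwρ_zero (tendsto_nodeShape_mul_sq G hδ m i hwρ) (m / 2) (Fintype.card (Parents G i)))
    simpa using ENNReal.Tendsto.sub (ENNReal.tendsto_finsetProd_of_ne_top Finset.univ
      (fun i _ => hnode i) fun i _ => ENNReal.ofReal_ne_top) tendsto_const_nhds
      (Or.inr ENNReal.one_ne_top)
  refine tendsto_of_tendsto_of_tendsto_of_le_of_le' tendsto_const_nhds hbound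
    (Eventually.of_forall fun _ => zero_le) ?_
  filter_upwards [hP, hρ_pos, hls, eventually_ge_atTop (m + 2)] with n hP hρ_pos hls hn
  have hmn : m ≤ n := by omega
  refine ENNReal.le_sub_of_add_le_right ENNReal.one_ne_top
    (covDivergence_add_one_le G hδ hτ hV hP hmn (by omega) (mul_pos hw hρ_pos) fun u => ?_)
  calc u ⬝ᵥ (bayesGram V (Q n) (X n) - residualGram (P n) (X n)) *ᵥ u
      ≤ leastSquares (Q n) (X n *ᵥ u) ⬝ᵥ V⁻¹ *ᵥ leastSquares (Q n) (X n *ᵥ u) :=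
        hP.quadraticForm_bayesGram_sub_residualGram_le (hP.posDef_gram hmn) hV (X n) u
    _ ≤ w * (leastSquares (Q n) (X n *ᵥ u) ⬝ᵥ leastSquares (Q n) (X n *ᵥ u)) := hwV _
    _ ≤ w * ρ n * (u ⬝ᵥ residualGram (P n) (X n) *ᵥ u) := by
      rw [quadraticForm_residualGram, mul_assoc]
      exact mul_le_mul_of_nonneg_left (hls u) hw.le

lemma tendsto_covDivergence_of_le_norm_sq_add {δ τ : ℝ} (hδ : 0 < δ) (hτ : 0 < τ)
    {V : Matrix (Fin m) (Fin m) ℝ} (hV : V.PosDef) {Q : (n : ℕ) → Matrix (Fin n) (Fin m) ℝ}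
    {X : (n : ℕ) → Matrix (Fin n) (Fin p) ℝ} {P : (n : ℕ) → Matrix (Fin n) (Fin (n - m)) ℝ}
    (hP : ∀ᶠ n in atTop, IsResidualContrast (Q n) (P n)) {r : ℕ → ℝ}
    (hr : Tendsto (fun n : ℕ => r n / √n) atTop atTop)
    (hXQ : ∀ᶠ n in atTop, ∀ (u : Fin p → ℝ) (v : Fin m → ℝ),
      r n * (v ⬝ᵥ v) ≤ (X n *ᵥ u + Q n *ᵥ v) ⬝ᵥ (X n *ᵥ u + Q n *ᵥ v)) :
    Tendsto (fun n => covDivergence G δ τ V (Q n) (P n) (X n)) atTop (𝓝 0) := by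
  have hr_pos : ∀ᶠ n in atTop, 0 < r n := by
    filter_upwards [hr.eventually_gt_atTop 0] with n hn
    exact pos_of_mul_pos_left hn (inv_nonneg.2 (Real.sqrt_nonneg _))
  have hr_inv : Tendsto (fun n : ℕ => √n * (r n)⁻¹) atTop (𝓝 0) := by
    refine (tendsto_inv_atTop_zero.comp hr).congr fun n => ?_
    rw [Function.comp_apply, inv_div, div_eq_mul_inv]
  refine tendsto_covDivergence G hδ hτ hV hP (hr_pos.mono fun n hn => inv_pos.2 hn) hr_inv ?_
  filter_upwards [hP, hr_pos, hXQ, eventually_ge_atTop m] with n hP hr_pos hXQ hmn u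
  have hcol := hXQ u (-leastSquares (Q n) (X n *ᵥ u))
  have hres := hP.norm_sq_sub (hP.posDef_gram hmn) (X n *ᵥ u) (leastSquares (Q n) (X n *ᵥ u))
  rw [sub_self, Matrix.mulVec_zero, zero_dotProduct, add_zero] at hres
  rw [Matrix.mulVec_neg, ← sub_eq_add_neg, hres, neg_dotProduct_neg] at hcol
  rwa [inv_mul_eq_div, le_div_iff₀' hr_pos]

end Criterion

/-! ### Growth rates -/

lemma tendsto_const_mul_div_sqrt {c : ℝ} (hc : 0 < c) :
    Tendsto (fun n : ℕ => c * n / √n) atTop atTop := by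
  refine ((Real.tendsto_sqrt_atTop.comp tendsto_natCast_atTop_atTop).const_mul_atTop hc).congr
    fun n => ?_
  rw [mul_div_assoc, Real.div_sqrt, Function.comp_apply]

lemma tendsto_log_div_sqrt :
    Tendsto (fun n : ℕ => Real.log (n + 1) / √n) atTop (𝓝 0) := by
  have hlog : (fun n : ℕ => Real.log (n + 1)) =o[atTop] fun n : ℕ => ((n : ℝ) + 1) ^ (1 / 2 : ℝ) :=
    (isLittleO_log_rpow_atTop (by norm_num)).comp_tendsto
      (tendsto_atTop_add_const_right _ _ tendsto_natCast_atTop_atTop)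
  have hsqrt : (fun n : ℕ => ((n : ℝ) + 1) ^ (1 / 2 : ℝ)) =O[atTop] fun n : ℕ => √n := by
    refine Asymptotics.IsBigO.of_bound 2 ?_
    filter_upwards [eventually_ge_atTop 1] with n hn
    have hn' : (1 : ℝ) ≤ n := by exact_mod_cast hn
    rw [← Real.sqrt_eq_rpow, Real.norm_of_nonneg (Real.sqrt_nonneg _),
      Real.norm_of_nonneg (Real.sqrt_nonneg _), Real.sqrt_le_left (by positivity), mul_pow,
      Real.sq_sqrt (by positivity)]
    linarith
  exact (hlog.trans_isBigO hsqrt).tendsto_div_nhds_zero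

lemma tendsto_log_div :
    Tendsto (fun n : ℕ => Real.log (n + 1) / n) atTop (𝓝 0) := by
  have hsqrt := Real.tendsto_sqrt_atTop.comp (tendsto_natCast_atTop_atTop (R := ℝ))
  refine (tendsto_log_div_sqrt.div_atTop hsqrt).congr fun n => ?_
  rw [Function.comp_apply, div_div, Real.mul_self_sqrt n.cast_nonneg]

lemma eventually_log_lt {c : ℝ} (hc : 0 < c) (K : ℝ) :
    ∀ᶠ n : ℕ in atTop, K * Real.log (n + 1) < c * n := by
  have hlim : Tendsto (fun n : ℕ => K * (Real.log (n + 1) / n)) atTop (𝓝 0) := by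
    simpa using tendsto_log_div.const_mul K
  filter_upwards [hlim.eventually_lt_const hc, eventually_gt_atTop 0] with n hlt hn
  rwa [← mul_div_assoc, div_lt_iff₀ (Nat.cast_pos.2 hn)] at hlt

lemma tendsto_sqrt_mul_log_div {c : ℝ} (hc : 0 < c) (F K L : ℝ) :
    Tendsto (fun n : ℕ => √n * ((F + L * Real.log (n + 1)) / (c * n - K * Real.log (n + 1))))
      atTop (𝓝 0) := by
  have hnum : Tendsto (fun n : ℕ => F / √n + L * (Real.log (n + 1) / √n)) atTop (𝓝 0) := by
    simpa using (tendsto_const_nhds.div_atTop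
      (Real.tendsto_sqrt_atTop.comp tendsto_natCast_atTop_atTop)).add
        (tendsto_log_div_sqrt.const_mul L)
  have hden : Tendsto (fun n : ℕ => c - K * (Real.log (n + 1) / n)) atTop (𝓝 c) := by
    simpa using (tendsto_log_div.const_mul K).const_sub c
  have hlim := hnum.div hden hc.ne'
  rw [zero_div] at hlim
  refine hlim.congr' ?_
  filter_upwards [eventually_gt_atTop 0, eventually_log_lt hc K] with n hn hlt
  have hn' : (0 : ℝ) < n := Nat.cast_pos.2 hn
  have hsqrt : √(n : ℝ) ≠ 0 := (Real.sqrt_pos.2 hn').ne'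
  have hden_ne : c * n - K * Real.log (n + 1) ≠ 0 := (sub_pos.2 hlt).ne'
  have hfac : c - K * (Real.log (n + 1) / n) = (c * n - K * Real.log (n + 1)) / (√n * √n) := by
    rw [Real.mul_self_sqrt hn'.le]
    field_simp
  rw [Pi.div_apply, hfac]
  field_simp

/-! ### Data from the model, for given errors -/

lemma exists_eventually_le_quadraticForm {ι α : Type*} [Fintype ι] {l : Filter α}
    {A : α → Matrix ι ι ℝ} {B : Matrix ι ι ℝ} (hB : B.PosDef) (hA : Tendsto A l (𝓝 B)) :
    ∃ c : ℝ, 0 < c ∧ ∀ᶠ t in l, ∀ u : ι → ℝ, c * (u ⬝ᵥ u) ≤ u ⬝ᵥ A t *ᵥ u := by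
  obtain ⟨c, hc, hcB⟩ := exists_le_quadraticForm hB
  have hdiff : Tendsto (fun t => ∑ j, (A t - B) j ⬝ᵥ (A t - B) j) l (𝓝 0) := by
    have hcont : Continuous fun M : Matrix ι ι ℝ => ∑ j, (M - B) j ⬝ᵥ (M - B) j := by
      simp only [dotProduct]
      fun_prop
    simpa [Function.comp_def, dotProduct] using (hcont.tendsto B).comp hA
  refine ⟨c / 2, half_pos hc, ?_⟩
  filter_upwards [hdiff.eventually_le_const (show 0 < (c / 2) ^ 2 by positivity)] with t ht u
  have hnorm : ((A t - B) *ᵥ u) ⬝ᵥ ((A t - B) *ᵥ u) ≤ (c / 2) ^ 2 * (u ⬝ᵥ u) :=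
    (norm_sq_mulVec_le (A t - B) u).trans
      (mul_le_mul_of_nonneg_right ht (dotProduct_self_nonneg u))
  have hsplit : u ⬝ᵥ A t *ᵥ u = u ⬝ᵥ B *ᵥ u + u ⬝ᵥ (A t - B) *ᵥ u := by
    rw [← quadraticForm_matrix_add, add_sub_cancel]
  have hamgm := dotProduct_self_nonneg ((c / 2) • u + (A t - B) *ᵥ u)
  simp only [add_dotProduct, dotProduct_add, smul_dotProduct, dotProduct_smul, smul_eq_mul,
    dotProduct_comm ((A t - B) *ᵥ u) u] at hamgm
  have hcross : -(c / 2 * (u ⬝ᵥ u)) ≤ u ⬝ᵥ (A t - B) *ᵥ u :=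
    le_of_mul_le_mul_left (by linarith) hc
  linarith [hcB u]

section Model

variable {p m n k : ℕ} {Q : Matrix (Fin n) (Fin m) ℝ} {P : Matrix (Fin n) (Fin k) ℝ}

lemma norm_sq_mulVec_leastSquares_mulVec_le (Q : Matrix (Fin n) (Fin m) ℝ)
    (E : Matrix (Fin n) (Fin p) ℝ) (v : Fin p → ℝ) :
    (Q *ᵥ leastSquares Q (E *ᵥ v)) ⬝ᵥ (Q *ᵥ leastSquares Q (E *ᵥ v)) ≤
      (∑ j, (Q *ᵥ leastSquares Q (E.col j)) ⬝ᵥ (Q *ᵥ leastSquares Q (E.col j))) *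
        (v ⬝ᵥ v) := by
  set B : Matrix (Fin n) (Fin p) ℝ := Q * ((Qᵀ * Q)⁻¹ * (Qᵀ * E)) with hB
  have hBv : ∀ w, B *ᵥ w = Q *ᵥ leastSquares Q (E *ᵥ w) := fun w => by
    rw [leastSquares, hB, ← Matrix.mulVec_mulVec, ← Matrix.mulVec_mulVec, ← Matrix.mulVec_mulVec]
  have hcol : ∀ j, Q *ᵥ leastSquares Q (E.col j) = B.col j := fun j => by
    rw [← Matrix.mulVec_single_one, ← hBv, Matrix.mulVec_single_one]
  simp_rw [← hBv, hcol]
  refine (norm_sq_mulVec_le B v).trans_eq (congrArg (· * (v ⬝ᵥ v)) ?_)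
  exact Finset.sum_comm

lemma IsResidualContrast.norm_sq_leastSquares_mulVec_add_le (h : IsResidualContrast Q P)
    (hQ : (Qᵀ * Q).PosDef) {d : Fin m → ℝ} {r : Fin n → ℝ} {σ F κ a s : ℝ} (hσ : 0 < σ)
    (hσQ : ∀ y, σ * (y ⬝ᵥ y) ≤ (Q *ᵥ y) ⬝ᵥ (Q *ᵥ y)) (hκ : 0 ≤ κ) (hκa : κ < a) (hF : 0 ≤ F)
    (hd : d ⬝ᵥ d ≤ F * s) (hr : a * s ≤ r ⬝ᵥ r)
    (hfit : (Q *ᵥ leastSquares Q r) ⬝ᵥ (Q *ᵥ leastSquares Q r) ≤ κ * s) :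
    leastSquares Q (Q *ᵥ d + r) ⬝ᵥ leastSquares Q (Q *ᵥ d + r) ≤
      (2 * F + 2 / σ * κ) / (a - κ) *
        ((Pᵀ *ᵥ (Q *ᵥ d + r)) ⬝ᵥ (Pᵀ *ᵥ (Q *ᵥ d + r))) := by
  set z := leastSquares Q r
  have hPr : Pᵀ *ᵥ (Q *ᵥ d + r) = Pᵀ *ᵥ r := by
    rw [Matrix.mulVec_add, Matrix.mulVec_mulVec, h.1, Matrix.zero_mulVec, zero_add]
  have hres : (a - κ) * s ≤ (Pᵀ *ᵥ r) ⬝ᵥ (Pᵀ *ᵥ r) := by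
    linarith [h.norm_sq_add hQ r]
  have hzz : z ⬝ᵥ z ≤ κ * s / σ := by
    rw [le_div_iff₀' hσ]
    exact (hσQ z).trans hfit
  have hsum : (d + z) ⬝ᵥ (d + z) ≤ 2 * (d ⬝ᵥ d) + 2 * (z ⬝ᵥ z) := by
    have := dotProduct_self_nonneg (d - z)
    simp only [sub_dotProduct, dotProduct_sub, add_dotProduct, dotProduct_add] at this ⊢
    linarith
  rw [hPr, leastSquares_mulVec_add hQ]
  calc (d + z) ⬝ᵥ (d + z) ≤ 2 * (F * s) + 2 * (κ * s / σ) := by linarith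
    _ = (2 * F + 2 / σ * κ) / (a - κ) * ((a - κ) * s) := by
      have : a - κ ≠ 0 := (sub_pos.2 hκa).ne'
      field_simp
    _ ≤ _ := mul_le_mul_of_nonneg_left hres
      (div_nonneg (by positivity) (sub_nonneg.2 hκa.le))

lemma norm_sq_firstRows_mulVec (q : ℕ → Fin m → ℝ) (y : Fin m → ℝ) (n : ℕ) :
    (firstRows q n *ᵥ y) ⬝ᵥ (firstRows q n *ᵥ y) = ∑ t ∈ Finset.range n, (q t ⬝ᵥ y) ^ 2 := by
  rw [Finset.sum_range]
  exact Finset.sum_congr rfl fun t _ => (sq _).symm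

lemma exists_eventually_le_norm_sq_firstRows_mulVec {q : ℕ → Fin m → ℝ} {n₀ : ℕ}
    (hq : ((firstRows q n₀)ᵀ * firstRows q n₀).PosDef) :
    ∃ σ : ℝ, 0 < σ ∧ ∀ᶠ n in atTop, ∀ y : Fin m → ℝ,
      σ * (y ⬝ᵥ y) ≤ (firstRows q n *ᵥ y) ⬝ᵥ (firstRows q n *ᵥ y) := by
  obtain ⟨σ, hσ, hσq⟩ := exists_le_quadraticForm hq
  refine ⟨σ, hσ, ?_⟩
  filter_upwards [eventually_ge_atTop n₀] with n hn y
  refine (hσq y).trans ?_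
  rw [quadraticForm_gram, norm_sq_firstRows_mulVec, norm_sq_firstRows_mulVec]
  exact Finset.sum_le_sum_of_subset_of_nonneg (Finset.range_mono hn) fun _ _ _ => sq_nonneg _

variable (G : Digraph (Fin p)) [DecidableRel G.Adj]

lemma isUnit_det_one_sub_coefMatrix (hG : IsAcyclic G) (θ : Params G) :
    IsUnit (1 - coefMatrix G θ).det := by
  rw [isUnit_iff_ne_zero]
  intro hdet
  obtain ⟨v, hv, hker⟩ := Matrix.exists_mulVec_eq_zero_iff.2 hdet
  rw [Matrix.sub_mulVec, Matrix.one_mulVec, sub_eq_zero] at hker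
  have : Std.Irrefl (Relation.TransGen G.Adj) := ⟨hG⟩
  have hwf : WellFounded (Relation.TransGen G.Adj) := Finite.wellFounded_of_trans_of_irrefl _
  refine hv (funext fun i => ?_)
  induction i using hwf.induction with
  | _ i ih =>
    rw [hker, Matrix.mulVec, dotProduct]
    refine Finset.sum_eq_zero fun j _ => ?_
    by_cases hji : G.Adj j i
    · rw [ih j (Relation.TransGen.single hji), Pi.zero_apply, mul_zero]
    · simp [coefMatrix, hji]

lemma firstRows_mul_one_sub_coefMatrix_transpose {b : Fin p → Fin m → ℝ} {q : ℕ → Fin m → ℝ}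
    {x ε : ℕ → Fin p → ℝ} {θ : Params G}
    (hx : ∀ t i, x t i = ∑ j : Parents G i, (θ i).1 j * x t j + q t ⬝ᵥ b i + ε t i) (n : ℕ) :
    firstRows x n * (1 - coefMatrix G θ)ᵀ =
      firstRows q n * (Matrix.of b)ᵀ + firstRows ε n := by
  have hparents : ∀ t i, ∑ j : Parents G i, (θ i).1 j * x t j =
      ∑ j, x t j * coefMatrix G θ i j := fun t i => by
    refine Fintype.sum_of_injective Subtype.val Subtype.val_injective _ _ (fun j hj => ?_)
      fun j => ?_
    · have : ¬ G.Adj j i := fun h => hj ⟨⟨j, h⟩, rfl⟩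
      simp [coefMatrix, this]
    · simp [coefMatrix, j.2, mul_comm]
  rw [Matrix.transpose_sub, Matrix.transpose_one, Matrix.mul_sub, Matrix.mul_one,
    sub_eq_iff_eq_add]
  ext t i
  refine (hx t i).trans ?_
  rw [hparents, add_assoc, add_comm]
  rfl

lemma tendsto_covDivergence_of_errors {δ τ : ℝ} (hδ : 0 < δ) (hτ : 0 < τ)
    {V : Matrix (Fin m) (Fin m) ℝ} (hV : V.PosDef) {q : ℕ → Fin m → ℝ} {x ε : ℕ → Fin p → ℝ}
    {P : (n : ℕ) → Matrix (Fin n) (Fin (n - m)) ℝ}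
    (hP : ∀ᶠ n in atTop, IsResidualContrast (firstRows q n) (P n))
    {A : Matrix (Fin p) (Fin p) ℝ} (hA : IsUnit A.det) {D : Matrix (Fin m) (Fin p) ℝ}
    (hx : ∀ n, firstRows x n * A = firstRows q n * D + firstRows ε n)
    {ψ : Fin p → ℝ} (hψ : ∀ i, 0 < ψ i)
    (hgram : Tendsto (fun n : ℕ => (n : ℝ)⁻¹ • ((firstRows ε n)ᵀ * firstRows ε n)) atTop
      (𝓝 (Matrix.diagonal ψ)))
    {K : ℝ} (hK : 0 ≤ K) (hfit : ∀ᶠ n : ℕ in atTop, ∑ j,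
      (firstRows q n *ᵥ leastSquares (firstRows q n) ((firstRows ε n).col j)) ⬝ᵥ
        (firstRows q n *ᵥ leastSquares (firstRows q n) ((firstRows ε n).col j)) ≤
      K * Real.log (n + 1)) :
    Tendsto (fun n => covDivergence G δ τ V (firstRows q n) (P n) (firstRows x n))
      atTop (𝓝 0) := by
  obtain ⟨n₀, hP₀, hmn₀⟩ := (hP.and (eventually_ge_atTop m)).exists
  obtain ⟨σ, hσ, hσq⟩ := exists_eventually_le_norm_sq_firstRows_mulVec (hP₀.posDef_gram hmn₀)
  obtain ⟨c, hc, hcε⟩ := exists_eventually_le_quadraticForm (Matrix.PosDef.diagonal hψ) hgram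
  set F : ℝ := 1 + ∑ l, D l ⬝ᵥ D l
  have hF : 0 < F := add_pos_of_pos_of_nonneg one_pos
    (Finset.sum_nonneg fun l _ => dotProduct_self_nonneg (D l))
  have hlog : ∀ n : ℕ, 0 ≤ K * Real.log (n + 1) := fun n =>
    mul_nonneg hK (Real.log_nonneg (le_add_of_nonneg_left n.cast_nonneg))
  refine tendsto_covDivergence G hδ hτ hV hP
    (ρ := fun n : ℕ => (2 * F + 2 / σ * (K * Real.log (n + 1))) / (c * n - K * Real.log (n + 1)))
    ?_ ?_ ?_
  · filter_upwards [eventually_log_lt hc K] with n hn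
    exact div_pos (add_pos_of_pos_of_nonneg (by positivity)
      (mul_nonneg (by positivity) (hlog n))) (sub_pos.2 hn)
  · simpa only [mul_assoc] using tendsto_sqrt_mul_log_div hc (2 * F) K (2 / σ * K)
  filter_upwards [hP, hσq, hcε, hfit, eventually_log_lt hc K, eventually_ge_atTop m,
    eventually_gt_atTop 0] with n hP hσq hcε hfit hKc hmn hn u
  obtain ⟨v, rfl⟩ : ∃ v, A *ᵥ v = u :=
    ⟨A⁻¹ *ᵥ u, by rw [Matrix.mulVec_mulVec, Matrix.mul_nonsing_inv _ hA, Matrix.one_mulVec]⟩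
  have hvv := dotProduct_self_nonneg v
  rw [Matrix.mulVec_mulVec, hx, Matrix.add_mulVec, ← Matrix.mulVec_mulVec]
  refine hP.norm_sq_leastSquares_mulVec_add_le (hP.posDef_gram hmn) hσ hσq (s := v ⬝ᵥ v)
    (hlog n) hKc hF.le ?_ ?_ ?_
  · linarith [norm_sq_mulVec_le D v]
  · have := hcε v
    rwa [quadraticForm_matrix_smul, quadraticForm_gram, le_inv_mul_iff₀ (Nat.cast_pos.2 hn),
      ← mul_assoc, mul_comm (n : ℝ)] at this
  · exact (norm_sq_mulVec_leastSquares_mulVec_le _ _ v).trans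
      (mul_le_mul_of_nonneg_right hfit hvv)

end Model

/-! ### Almost sure behaviour of the errors -/

section Fitted

variable {n m : ℕ} {Q : Matrix (Fin n) (Fin m) ℝ}

open scoped MatrixOrder in
lemma exists_orthonormal_norm_sq_mulVec_leastSquares (hQ : IsUnit (Qᵀ * Q).det) :
    ∃ U : Matrix (Fin n) (Fin m) ℝ, Uᵀ * U = 1 ∧ ∀ r,
      (Q *ᵥ leastSquares Q r) ⬝ᵥ (Q *ᵥ leastSquares Q r) = (Uᵀ *ᵥ r) ⬝ᵥ (Uᵀ *ᵥ r) := by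
  have hpsd : ((Qᵀ * Q)⁻¹).PosSemidef := (Matrix.posSemidef_conjTranspose_mul_self Q).inv
  obtain ⟨B, hB⟩ := CStarAlgebra.nonneg_iff_eq_star_mul_self.mp hpsd.nonneg
  rw [Matrix.star_eq_conjTranspose, Matrix.conjTranspose_eq_transpose_of_trivial] at hB
  refine ⟨Q * Bᵀ, ?_, fun r => ?_⟩
  · have hleft : Bᵀ * (B * (Qᵀ * Q)) = 1 := by
      rw [← Matrix.mul_assoc, ← hB, Matrix.nonsing_inv_mul _ hQ]
    rw [Matrix.transpose_mul, Matrix.transpose_transpose, Matrix.mul_assoc,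
      ← Matrix.mul_assoc Qᵀ, ← Matrix.mul_assoc]
    exact mul_eq_one_comm.1 hleft
  · rw [← quadraticForm_gram, leastSquares, Matrix.mulVec_mulVec _ (Qᵀ * Q),
      Matrix.mul_nonsing_inv _ hQ, Matrix.one_mulVec, Matrix.transpose_mul,
      Matrix.transpose_transpose, ← Matrix.mulVec_mulVec, ← quadraticForm_gram B, ← hB,
      dotProduct_comm]

-- For a singular Gram matrix this still holds, because `leastSquares` is then the junk value `0`.
lemma exists_norm_sq_mulVec_leastSquares (Q : Matrix (Fin n) (Fin m) ℝ) :
    ∃ U : Matrix (Fin n) (Fin m) ℝ, (∀ l, U.col l ⬝ᵥ U.col l ≤ 1) ∧ ∀ r,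
      (Q *ᵥ leastSquares Q r) ⬝ᵥ (Q *ᵥ leastSquares Q r) = ∑ l, (U.col l ⬝ᵥ r) ^ 2 := by
  have hsq : ∀ (U : Matrix (Fin n) (Fin m) ℝ) r,
      (Uᵀ *ᵥ r) ⬝ᵥ (Uᵀ *ᵥ r) = ∑ l, (U.col l ⬝ᵥ r) ^ 2 := fun U r =>
    Finset.sum_congr rfl fun l _ => (sq _).symm
  by_cases hQ : IsUnit (Qᵀ * Q).det
  · obtain ⟨U, hU, hfit⟩ := exists_orthonormal_norm_sq_mulVec_leastSquares hQ
    exact ⟨U, fun l => (congrFun (congrFun hU l) l).le.trans_eq (Matrix.one_apply_eq l),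
      fun r => (hfit r).trans (hsq U r)⟩
  · refine ⟨0, fun l => by simp [dotProduct], fun r => ?_⟩
    simp [leastSquares, Matrix.nonsing_inv_apply_not_isUnit _ hQ, dotProduct]

end Fitted

section Subgaussian

variable {Ω : Type*} [MeasurableSpace Ω] {μ : Measure Ω}

lemma hasSubgaussianMGF_of_hasLaw {X : Ω → ℝ} {v : ℝ≥0} (h : HasLaw X (gaussianReal 0 v) μ) :
    HasSubgaussianMGF X v μ := by
  refine HasSubgaussianMGF.of_map (X := id) h.aemeasurable ?_
  rw [h.map_eq]
  refine ⟨fun t => integrable_exp_mul_gaussianReal t, fun t => ?_⟩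
  rw [mgf_id_gaussianReal]
  simp

lemma hasSubgaussianMGF_dotProduct {ι : Type*} [Fintype ι] {Y : ι → Ω → ℝ} {v : ℝ≥0}
    (hind : iIndepFun Y μ) (hY : ∀ i, HasSubgaussianMGF (Y i) v μ) {u : ι → ℝ}
    (hu : u ⬝ᵥ u ≤ 1) : HasSubgaussianMGF (fun ω => u ⬝ᵥ fun i => Y i ω) v μ := by
  have hterm : ∀ i, HasSubgaussianMGF (fun ω => u i * Y i ω) (‖u i‖₊ ^ 2 * v) μ := fun i => by
    convert (hY i).const_mul (u i)
    exact congrArg (· * v) (NNReal.eq (sq_abs (u i)))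
  have hsum := HasSubgaussianMGF.sum_of_iIndepFun
    (hind.comp (fun i y => u i * y) fun i => by fun_prop) (s := Finset.univ) fun i _ => hterm i
  have hnorm : ∑ i, ‖u i‖₊ ^ 2 ≤ 1 := NNReal.coe_le_coe.1 (by simpa [dotProduct, sq] using hu)
  refine ⟨hsum.integrable_exp_mul, fun t => (hsum.mgf_le t).trans (Real.exp_le_exp.2 ?_)⟩
  gcongr
  rw [← Finset.sum_mul]
  exact mul_le_of_le_one_left zero_le hnorm

lemma measureReal_abs_ge_le {X : Ω → ℝ} {v : ℝ≥0} (h : HasSubgaussianMGF X v μ) {r : ℝ}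
    (hr : 0 ≤ r) : μ.real {ω | r ≤ |X ω|} ≤ 2 * Real.exp (-r ^ 2 / (2 * v)) := by
  have hunion : {ω | r ≤ |X ω|} = {ω | r ≤ X ω} ∪ {ω | r ≤ (-X) ω} :=
    Set.ext fun ω => le_abs (b := X ω)
  rw [hunion]
  linarith [measureReal_union_le (μ := μ) {ω | r ≤ X ω} {ω | r ≤ (-X) ω},
    h.measure_ge_le hr, h.neg.measure_ge_le hr]

-- The tail at `√(4 v log (n + 1))` is at most `2 / (n + 1)²`, so Borel-Cantelli applies.
lemma ae_eventually_sq_le_log [IsFiniteMeasure μ] {Y : ℕ → Ω → ℝ} {v : ℝ≥0} (hv : 0 < v)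
    (hY : ∀ n, HasSubgaussianMGF (Y n) v μ) :
    ∀ᵐ ω ∂μ, ∀ᶠ n : ℕ in atTop, Y n ω ^ 2 ≤ 4 * v * Real.log (n + 1) := by
  set r : ℕ → ℝ := fun n => √(4 * v * Real.log (n + 1))
  have hr_sq : ∀ n, r n ^ 2 = 4 * v * Real.log (n + 1) := fun n => Real.sq_sqrt
    (mul_nonneg (by positivity) (Real.log_nonneg (le_add_of_nonneg_left n.cast_nonneg)))
  have htail : ∀ n, μ.real {ω | r n ≤ |Y n ω|} ≤ 2 * (1 / ((n + 1 : ℕ) : ℝ) ^ 2) := fun n => by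
    refine (measureReal_abs_ge_le (hY n) (Real.sqrt_nonneg _)).trans_eq (congrArg (2 * ·) ?_)
    have hv' : (v : ℝ) ≠ 0 := (NNReal.coe_pos.2 hv).ne'
    have hexponent : -r n ^ 2 / (2 * v) = -(2 * Real.log (n + 1)) := by
      rw [hr_sq]
      field_simp
      ring
    have hn : (0 : ℝ) < n + 1 := by positivity
    rw [hexponent, Real.exp_neg, ← Nat.cast_two, Real.exp_nat_mul, Real.exp_log hn, one_div,
      Nat.cast_add_one]
  have hsummable : Summable fun n : ℕ => 2 * (1 / ((n + 1 : ℕ) : ℝ) ^ 2) :=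
    ((summable_nat_add_iff 1).2 (Real.summable_one_div_nat_pow.2 one_lt_two)).mul_left 2
  have htsum : ∑' n, μ {ω | r n ≤ |Y n ω|} ≠ ∞ := by
    refine ne_top_of_le_ne_top hsummable.tsum_ofReal_ne_top (ENNReal.tsum_le_tsum fun n => ?_)
    rw [← ofReal_measureReal]
    exact ENNReal.ofReal_le_ofReal (htail n)
  filter_upwards [ae_eventually_notMem htsum] with ω hω
  filter_upwards [hω] with n hn
  rw [← hr_sq, ← sq_abs]
  exact pow_le_pow_left₀ (abs_nonneg _) (not_le.1 hn).le 2

end Subgaussian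

section Errors

variable {Ω : Type*} [MeasurableSpace Ω] {μ : Measure Ω} {p m : ℕ} {ε : ℕ × Fin p → Ω → ℝ}
  {ψ : Fin p → ℝ≥0}

lemma ae_eventually_fitted_errors_le [IsFiniteMeasure μ] (hind : iIndepFun ε μ)
    (hlaw : ∀ t i, HasLaw (ε (t, i)) (gaussianReal 0 (ψ i)) μ) (hψ : ∀ i, 0 < ψ i)
    (Q : (n : ℕ) → Matrix (Fin n) (Fin m) ℝ) :
    ∀ᵐ ω ∂μ, ∀ᶠ n : ℕ in atTop, ∑ j,
      (Q n *ᵥ leastSquares (Q n) ((firstRows (fun t i => ε (t, i) ω) n).col j)) ⬝ᵥ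
        (Q n *ᵥ leastSquares (Q n) ((firstRows (fun t i => ε (t, i) ω) n).col j)) ≤
      (∑ j, (m : ℝ) * (4 * ψ j)) * Real.log (n + 1) := by
  choose U hU hfit using fun n => exists_norm_sq_mulVec_leastSquares (Q n)
  have hind_col : ∀ (n : ℕ) j, iIndepFun (fun t : Fin n => ε (t, j)) μ := fun n j =>
    hind.precomp (g := fun t : Fin n => ((t : ℕ), j)) fun s t hst => Fin.ext (Prod.ext_iff.1 hst).1
  have hcontrast : ∀ᵐ ω ∂μ, ∀ j l, ∀ᶠ n : ℕ in atTop,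
      ((U n).col l ⬝ᵥ fun t : Fin n => ε (t, j) ω) ^ 2 ≤ 4 * ψ j * Real.log (n + 1) := by
    simp only [ae_all_iff]
    exact fun j l => ae_eventually_sq_le_log (hψ j) fun n => hasSubgaussianMGF_dotProduct
      (hind_col n j) (fun t => hasSubgaussianMGF_of_hasLaw (hlaw t j)) (hU n l)
  filter_upwards [hcontrast] with ω hω
  simp only [← eventually_all] at hω
  filter_upwards [hω] with n hn
  rw [Finset.sum_mul]
  refine Finset.sum_le_sum fun j _ => ?_
  rw [hfit, mul_assoc]
  calc ∑ l, ((U n).col l ⬝ᵥ fun t : Fin n => ε (t, j) ω) ^ 2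
      ≤ ∑ _l : Fin m, 4 * ψ j * Real.log (n + 1) := Finset.sum_le_sum fun l _ => hn j l
    _ = m * (4 * ψ j * Real.log (n + 1)) := by simp

lemma integral_mul_errors [IsProbabilityMeasure μ] (hind : iIndepFun ε μ)
    (hlaw : ∀ t i, HasLaw (ε (t, i)) (gaussianReal 0 (ψ i)) μ) (t : ℕ) (j k : Fin p) :
    ∫ ω, ε (t, j) ω * ε (t, k) ω ∂μ = if j = k then (ψ j : ℝ) else 0 := by
  have hmean : ∀ i, ∫ ω, ε (t, i) ω ∂μ = 0 := fun i => by
    rw [(hlaw t i).integral_eq, integral_id_gaussianReal]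
  have hmeas : ∀ i, AEMeasurable (ε (t, i)) μ := fun i => (hlaw t i).aemeasurable
  split_ifs with hjk
  · subst hjk
    have hvar := (hlaw t j).variance_eq
    rw [variance_id_gaussianReal, variance_of_integral_eq_zero (hmeas j) (hmean j)] at hvar
    simpa only [sq] using hvar
  · have hne : ((t, j) : ℕ × Fin p) ≠ (t, k) := fun h => hjk (Prod.ext_iff.1 h).2
    rw [(hind.indepFun hne).integral_fun_mul_eq_mul_integral (hmeas j).aestronglyMeasurable
      (hmeas k).aestronglyMeasurable, hmean, zero_mul]

lemma identDistrib_mul_errors [IsFiniteMeasure μ] (hind : iIndepFun ε μ)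
    (hlaw : ∀ t i, HasLaw (ε (t, i)) (gaussianReal 0 (ψ i)) μ) (s t : ℕ) (j k : Fin p) :
    IdentDistrib (fun ω => ε (s, j) ω * ε (s, k) ω) (fun ω => ε (t, j) ω * ε (t, k) ω) μ μ := by
  have hid : ∀ i, IdentDistrib (ε (s, i)) (ε (t, i)) μ μ := fun i =>
    ⟨(hlaw s i).aemeasurable, (hlaw t i).aemeasurable,
      (hlaw s i).map_eq.trans (hlaw t i).map_eq.symm⟩
  by_cases hjk : j = k
  · subst hjk
    exact (hid j).comp (u := fun y => y * y) (by fun_prop)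
  · have hne : ∀ r : ℕ, ((r, j) : ℕ × Fin p) ≠ (r, k) := fun r h => hjk (Prod.ext_iff.1 h).2
    exact ((hid j).prodMk (hid k) (hind.indepFun (hne s)) (hind.indepFun (hne t))).comp
      (u := fun y : ℝ × ℝ => y.1 * y.2) (by fun_prop)

lemma ae_tendsto_average_mul_errors [IsProbabilityMeasure μ] (hind : iIndepFun ε μ)
    (hlaw : ∀ t i, HasLaw (ε (t, i)) (gaussianReal 0 (ψ i)) μ) (j k : Fin p) :
    ∀ᵐ ω ∂μ, Tendsto (fun n : ℕ => (∑ t ∈ Finset.range n, ε (t, j) ω * ε (t, k) ω) / n) atTop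
      (𝓝 (if j = k then (ψ j : ℝ) else 0)) := by
  have hmeas : ∀ z : ℕ × Fin p, AEMeasurable (ε z) μ := fun z => (hlaw z.1 z.2).aemeasurable
  have hmem : ∀ i, MemLp (ε (0, i)) 2 μ := fun i => by
    have : MemLp id 2 (μ.map (ε (0, i))) := by
      rw [(hlaw 0 i).map_eq]
      exact memLp_id_gaussianReal 2
    exact (memLp_map_measure_iff aestronglyMeasurable_id (hmeas _)).1 this
  have hmul : Measurable fun z : ℝ × ℝ => z.1 * z.2 := by fun_prop
  have hindep : ∀ s t, s ≠ t → (fun ω => ε (s, j) ω * ε (s, k) ω) ⟂ᵢ[μ]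
      (fun ω => ε (t, j) ω * ε (t, k) ω) := fun s t hst => by
    have hne : ∀ a b : Fin p, ((s, a) : ℕ × Fin p) ≠ (t, b) := fun a b h =>
      hst (Prod.ext_iff.1 h).1
    exact (hind.indepFun_prodMk_prodMk₀ hmeas (s, j) (s, k) (t, j) (t, k) (hne _ _) (hne _ _)
      (hne _ _) (hne _ _)).comp hmul hmul
  rw [← integral_mul_errors hind hlaw 0 j k]
  exact strong_law_ae_real (fun t ω => ε (t, j) ω * ε (t, k) ω)
    ((hmem j).integrable_mul (hmem k)) (fun s t hst => hindep s t hst)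
    fun t => identDistrib_mul_errors hind hlaw t 0 j k

lemma ae_tendsto_gram_errors [IsProbabilityMeasure μ] (hind : iIndepFun ε μ)
    (hlaw : ∀ t i, HasLaw (ε (t, i)) (gaussianReal 0 (ψ i)) μ) :
    ∀ᵐ ω ∂μ, Tendsto (fun n : ℕ => (n : ℝ)⁻¹ • ((firstRows (fun t i => ε (t, i) ω) n)ᵀ *
      firstRows (fun t i => ε (t, i) ω) n)) atTop (𝓝 (Matrix.diagonal fun i => (ψ i : ℝ))) := by
  have hentry := ae_all_iff.2 fun j => ae_all_iff.2 fun k =>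
    ae_tendsto_average_mul_errors hind hlaw j k
  filter_upwards [hentry] with ω hω
  refine tendsto_pi_nhds.2 fun j => tendsto_pi_nhds.2 fun k => ?_
  refine (hω j k).congr fun n => ?_
  rw [div_eq_inv_mul, Finset.sum_range]
  rfl

end Errors

end ExoNetwork

open ExoNetwork in
theorem theorem1_general {p m : ℕ} (G : Digraph (Fin p)) [DecidableRel G.Adj] (δ τ : ℝ)
    (hδ : 0 < δ) (hτ : 0 < τ) (V : Matrix (Fin m) (Fin m) ℝ) (hV : V.PosDef) :
    (∀ {Ω : Type*} [MeasurableSpace Ω] (μ : Measure Ω) [IsProbabilityMeasure μ]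
        (γ : (i : Fin p) → Parents G i → ℝ) (ψ : Fin p → ℝ≥0)
        (b : Fin p → Fin m → ℝ) (q : ℕ → Fin m → ℝ) (x : ℕ → Fin p → Ω → ℝ)
        (P : (n : ℕ) → Matrix (Fin n) (Fin (n - m)) ℝ),
        (∀ i, 0 < ψ i) → IsUnit (1 - coefMatrix G fun i => (γ i, (ψ i : ℝ))).det →
        FollowsModel G μ γ ψ b q x →
        (∀ᶠ n in atTop, IsResidualContrast (firstRows q n) (P n)) →
        ∀ᵐ ω ∂μ, Tendsto (fun n => covDivergence G δ τ V (firstRows q n) (P n)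
          (firstRows (fun t i => x t i ω) n)) atTop (𝓝 0)) ∧
    (∀ (Q : (n : ℕ) → Matrix (Fin n) (Fin m) ℝ) (X : (n : ℕ) → Matrix (Fin n) (Fin p) ℝ)
        (P : (n : ℕ) → Matrix (Fin n) (Fin (n - m)) ℝ) (r : ℕ → ℝ),
        Tendsto (fun n : ℕ => r n / √n) atTop atTop →
        (∀ᶠ n in atTop, IsResidualContrast (Q n) (P n)) →
        (∀ᶠ n : ℕ in atTop, ∀ (u : Fin p → ℝ) (v : Fin m → ℝ),
          r n * (v ⬝ᵥ v) ≤ (X n *ᵥ u + Q n *ᵥ v) ⬝ᵥ (X n *ᵥ u + Q n *ᵥ v)) →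
        Tendsto (fun n => covDivergence G δ τ V (Q n) (P n) (X n)) atTop (𝓝 0)) := by
  refine ⟨?_, fun Q X P r hr hP hXQ =>
    tendsto_covDivergence_of_le_norm_sq_add G hδ hτ hV hP hr hXQ⟩
  rintro Ω _ μ _ γ ψ b q x P hψ hdet ⟨ε, hind, hlaw, hx⟩ hP
  filter_upwards [ae_tendsto_gram_errors hind hlaw,
    ae_eventually_fitted_errors_le hind hlaw hψ (firstRows q)] with ω hgram hfit
  exact tendsto_covDivergence_of_errors G hδ hτ hV hP (by rwa [Matrix.det_transpose])
    (firstRows_mul_one_sub_coefMatrix_transpose G fun t i => hx t i ω)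
    (fun i => NNReal.coe_pos.2 (hψ i)) hgram (by positivity) hfit

theorem theorem1 {p m : ℕ} (G : Digraph (Fin p)) [DecidableRel G.Adj]
    (hG : ExoNetwork.IsAcyclic G) (δ τ : ℝ) (hδ : 0 < δ) (hτ : 0 < τ)
    (V : Matrix (Fin m) (Fin m) ℝ) (hV : V.PosDef) :
    -- random data that follow the model
    (∀ {Ω : Type*} [MeasurableSpace Ω] (μ : Measure Ω) [IsProbabilityMeasure μ]
        (γ : (i : Fin p) → ExoNetwork.Parents G i → ℝ) (ψ : Fin p → ℝ≥0)
        (b : Fin p → Fin m → ℝ) (q : ℕ → Fin m → ℝ) (x : ℕ → Fin p → Ω → ℝ)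
        (P : (n : ℕ) → Matrix (Fin n) (Fin (n - m)) ℝ),
        (∀ i, 0 < ψ i) →
        ExoNetwork.FollowsModel G μ γ ψ b q x →
        (∃ n, (ExoNetwork.firstRows q n).rank = m) →
        (∀ᶠ n in atTop, ExoNetwork.IsResidualContrast (ExoNetwork.firstRows q n) (P n)) →
        ∀ᵐ ω ∂μ, Tendsto
          (fun n => ExoNetwork.covDivergence G δ τ V (ExoNetwork.firstRows q n) (P n)
            (ExoNetwork.firstRows (fun t i => x t i ω) n)) atTop (𝓝 0)) ∧
    -- given (for example centred and scaled) data, asymptotically not collinear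
    (∀ (Q : (n : ℕ) → Matrix (Fin n) (Fin m) ℝ) (X : (n : ℕ) → Matrix (Fin n) (Fin p) ℝ)
        (P : (n : ℕ) → Matrix (Fin n) (Fin (n - m)) ℝ) (c C : ℝ),
        0 < c →
        (∀ᶠ n in atTop, ExoNetwork.IsResidualContrast (Q n) (P n)) →
        (∀ᶠ n : ℕ in atTop, ∀ i, (X n).col i ⬝ᵥ (X n).col i ≤ C * n) →
        (∀ᶠ n : ℕ in atTop, ∀ (u : Fin p → ℝ) (v : Fin m → ℝ),
          c * n * (u ⬝ᵥ u + v ⬝ᵥ v) ≤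
            (X n *ᵥ u + Q n *ᵥ v) ⬝ᵥ (X n *ᵥ u + Q n *ᵥ v)) →
        Tendsto (fun n => ExoNetwork.covDivergence G δ τ V (Q n) (P n) (X n))
          atTop (𝓝 0)) := by
  obtain ⟨hmodel, hgiven⟩ := theorem1_general G δ τ hδ hτ V hV
  refine ⟨fun μ _ γ ψ b q x P hψ hx _ hP => hmodel μ γ ψ b q x P hψ
      (ExoNetwork.isUnit_det_one_sub_coefMatrix G hG _) hx hP,
    fun Q X P c C hc hP _ hXQ => hgiven Q X P (fun n => c * n)
      (ExoNetwork.tendsto_const_mul_div_sqrt hc) hP (hXQ.mono fun n hn u v => ?_)⟩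
  exact (mul_le_mul_of_nonneg_left (le_add_of_nonneg_left
    (ExoNetwork.dotProduct_self_nonneg u)) (by positivity)).trans (hn u v)
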